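/- **Setting.** Let $\mathcal H_0$ be a complex Hilbert space with inner product $\langle\cdot,\cdot\rangle$ and norm $\|\cdot\|_0$, and let $\mathcal G_0$ be a Hilbert space consisting of the same elements with an equivalent norm; write $(\cdot,\cdot)_0$ and $|\cdot|_0$ for its inner product and norm. Let $A$ be a positive definite selfadjoint operator in $\mathcal H_0$ (i.e. $\langle Ax,x\rangle\ge\alpha\|x\|_0^2$ on $\mathcal D(A)$ for some $\alpha>0$), and let $M$ be a positive definite selfadjoint operator in $\mathcal G_0$ with $M^{-1}$ compact. For $s>0$ the powers $A^s$, $M^s$ are those of the spectral calculus, and $\|x\|_s=\|A^sx\|_0$ for $x\in\mathcal D(A^s)$. Let $0<\mu_1\le\mu_2\le\dots$ be the eigenvalues of $M$, counted according to multiplicity, with corresponding $\mathcal G_0$-orthonormal eigenvectors $q_1,q_2,\dots$, and let $\lambda_1\le\lambda_2\le\dots$ be the eigenvalues of $A$, counted according to multiplicity, with corresponding $\mathcal H_0$-orthonormal eigenvectors $u_1,u_2,\dots$. (Under the hypotheses below $A^{-1}$ is compact.) For each $n$ let $(\Lambda_j^{(n)},u_j^{(n,1/2)})$, $1\le j\le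 n$, be the regular Rayleigh–Ritz eigenpairs of $A$ for the trial vectors $q_1,\dots,q_n$: $\Lambda^{(n)}_1\le\dots\le\Lambda^{(n)}_n$, the $u_j^{(n,1/2)}$ are $\mathcal H_0$-orthonormal, and $u_j^{(n,1/2)}=\sum_i x_iq_i$ where $\big[\langle A^{1/2}q_i,A^{1/2}q_k\rangle\big]x=\Lambda_j^{(n)}\big[\langle q_i,q_k\rangle\big]x$ (inner products conjugate-linear in the first argument). **Theorem.** Let $\tau>1/2$ and $\sigma\ge 2\tau-1/2$. Assume that $\mathcal D(M^\tau)=\mathcal D(A^\tau)$ with equivalent norms $|M^\tau x|_0$ and $\|A^\tau x\|_0$, and that $\mathcal D(M^{2\tau-1/2})\subset\mathcal D(A^{2\tau-1/2})$ with continuous injection. Let $\ell$ be such that $\lambda_\ell<\lambda_{\ell+1}$, so that $\mathrm{span}\{u_1,\dots,u_\ell\}$ is the range of a spectral projection of $A$, and suppose that for each $j=1,\dots,\ell$ one has $u_j\in\mathcal D(M^\sigma)$ and $$\frac{\sum_{k=n+1}^\infty\mu_k^{4\tau-1}|(u_j,q_k)_0|^2}{\sum_{k=n+1}^\infty\mu_k^{2\tau}|(u_j,q_k)_0|^2}=O\big(\mu_{n+1}^{2\tau-1}\big)\quad\text{as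 }n\to\infty,$$ the quotient being read as $0$ when both sums vanish. Then for each $j=1,\dots,\ell$ there are eigenvectors $u_{j,n}$ of $A$ in the $\lambda_j$-eigenspace, normalized in $\mathcal H_0$, such that $u_{j,n}-u_j^{(n,1/2)}\in\mathcal D(A^\tau)$ for $n\ge j$ and $$\|u_{j,n}-u_j^{(n,1/2)}\|_\tau=o\big(\mu_{n+1}^{\tau-\sigma}\big)\quad\text{as }n\to\infty.$$ If, moreover, $\lambda_j$ is a simple eigenvalue and the Rayleigh–Ritz eigenvectors are oriented so that $\langle u_j,u_j^{(n,1/2)}\rangle$ is real and nonnegative for all $n\ge j$, then $u_j-u_j^{(n,1/2)}\in\mathcal D(A^\tau)$ for $n\ge j$ and $\|u_j-u_j^{(n,1/2)}\|_\tau=o\big(\mu_{n+1}^{\tau-\sigma}\big)$ as $n\to\infty$. -/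

import Mathlib

open Filter Asymptotics
open scoped Topology

noncomputable section

namespace FracRitz

/-- An unbounded operator `A` is positive definite if `⟨A x, x⟩ ≥ α ‖x‖²` on its domain, for
some constant `α > 0`. -/
def IsPositiveDefinite {H : Type*} [NormedAddCommGroup H] [InnerProductSpace ℂ H]
    (A : H →ₗ.[ℂ] H) : Prop :=
  ∃ α : ℝ, 0 < α ∧ ∀ x : A.domain, α * ‖(x : H)‖ ^ 2 ≤ (inner ℂ (x : H) (A x)).re

/-- A positive definite selfadjoint operator has an everywhere defined bounded inverse. -/
theorem exists_bounded_inverse {H : Type*} [NormedAddCommGroup H] [InnerProductSpace ℂ H]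
    [CompleteSpace H] (A : H →ₗ.[ℂ] H) (hA : IsSelfAdjoint A) (hpos : IsPositiveDefinite A) :
    ∃ T : H →L[ℂ] H, ∀ x y : H, T y = x ↔ (x, y) ∈ A.graph := by
  obtain ⟨α, hα, hle⟩ := hpos
  have hb : ∀ x : A.domain, α * ‖(x : H)‖ ≤ ‖A x‖ := by
    intro x
    have h1 := hle x
    have h2 : (inner ℂ (x : H) (A x)).re ≤ ‖(x : H)‖ * ‖A x‖ :=
      (Complex.re_le_norm _).trans (norm_inner_le_norm _ _)
    rcases (norm_nonneg (x : H)).eq_or_lt with h0 | h0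
    · rw [← h0]; simp
    · nlinarith
  have hinj : ∀ x : A.domain, A x = 0 → x = 0 := by
    intro x hx
    have := hb x
    rw [hx, norm_zero] at this
    have h3 : ‖(x : H)‖ = 0 := by nlinarith [norm_nonneg (x : H)]
    exact Subtype.ext (norm_eq_zero.mp h3)
  have hdense := hA.dense_domain
  have hclosed : IsClosed (A.graph : Set (H × H)) := hA.isClosed
  set R : Submodule ℂ H := LinearMap.range A.toFun with hR
  have hRclosed : IsClosed (R : Set H) := by
    apply IsSeqClosed.isClosed
    intro y y' hy hlim
    choose x hx using hy
    have hx' : ∀ n, A (x n) = y n := hx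
    have hc : CauchySeq (fun n => (x n : H)) := by
      have hyc := hlim.cauchySeq
      rw [Metric.cauchySeq_iff] at hyc ⊢
      intro ε hε
      obtain ⟨N, hN⟩ := hyc (α * ε) (by positivity)
      refine ⟨N, fun m hm n hn => ?_⟩
      have h4 := hN m hm n hn
      rw [dist_eq_norm] at h4 ⊢
      have h5 := hb (x m - x n)
      rw [A.map_sub, hx', hx'] at h5
      have h6 : ((x m - x n : A.domain) : H) = (x m : H) - x n := rfl
      rw [h6] at h5
      nlinarith
    obtain ⟨x', hx'lim⟩ := cauchySeq_tendsto_of_complete hc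
    have hmem : (x', y') ∈ A.graph := by
      refine hclosed.mem_of_tendsto (hx'lim.prodMk_nhds hlim) (Eventually.of_forall fun n => ?_)
      rw [← hx' n]
      exact A.mem_graph (x n)
    obtain ⟨z, -, hz⟩ := (LinearPMap.mem_graph_iff A).mp hmem
    exact ⟨z, hz⟩
  have hRperp : Rᗮ = ⊥ := by
    rw [Submodule.eq_bot_iff]
    intro z hz
    have hz' : ∀ x : A.domain, inner ℂ z (A x) = 0 := fun x =>
      (Submodule.mem_orthogonal' R z).mp hz _ ⟨x, rfl⟩
    have hadj : LinearPMap.adjoint A = A := hA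
    have hzd : z ∈ (LinearPMap.adjoint A).domain :=
      LinearPMap.mem_adjoint_domain_of_exists z ⟨0, fun x => by rw [hz' x, inner_zero_left]⟩
    have h7 : LinearPMap.adjoint A ⟨z, hzd⟩ = 0 :=
      LinearPMap.adjoint_apply_eq hdense ⟨z, hzd⟩ fun x => by rw [hz' x, inner_zero_left]
    have h8 : (z, (0 : H)) ∈ (LinearPMap.adjoint A).graph := by
      rw [← h7]; exact LinearPMap.mem_graph _ ⟨z, hzd⟩
    rw [hadj] at h8
    obtain ⟨z0, hz0, hz1⟩ := (LinearPMap.mem_graph_iff A).mp h8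
    rw [hinj z0 hz1] at hz0
    simpa using hz0.symm
  have hRtop : R = ⊤ := by
    have : CompleteSpace R := hRclosed.completeSpace_coe
    exact Submodule.orthogonal_eq_bot_iff.mp hRperp
  have hsurj : ∀ y : H, ∃ x : A.domain, A x = y := by
    intro y
    have : y ∈ R := by rw [hRtop]; trivial
    exact this
  have hinj2 : ∀ x x' : A.domain, A x = A x' → x = x' := by
    intro x x' h
    exact sub_eq_zero.mp (hinj _ (by rw [A.map_sub, h, sub_self]))
  choose g hg using hsurj
  let L : H →ₗ[ℂ] H :=
    { toFun := fun y => g y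
      map_add' := fun y z => by
        have : g (y + z) = g y + g z := hinj2 _ _ (by rw [A.map_add, hg, hg, hg])
        rw [this]; rfl
      map_smul' := fun c y => by
        have : g (c • y) = c • g y := hinj2 _ _ (by rw [A.map_smul, hg, hg])
        rw [this]; rfl }
  refine ⟨L.mkContinuous α⁻¹ fun y => ?_, fun x y => ?_⟩
  · have h9 := hb (g y)
    rw [hg] at h9
    have h10 : ‖L y‖ = ‖(g y : H)‖ := rfl
    rw [h10, inv_mul_eq_div, le_div_iff₀ hα]
    linarith
  · constructor
    · rintro rfl
      have h11 := A.mem_graph (g y)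
      rw [hg] at h11
      exact h11
    · intro h
      obtain ⟨z, hz, hz'⟩ := (LinearPMap.mem_graph_iff A).mp h
      have : g y = z := hinj2 _ _ (by rw [hg]; exact hz'.symm)
      change ((g y : A.domain) : H) = x
      rw [this]; exact hz

open Classical in
/-- The bounded inverse `A⁻¹ : H → H` of an unbounded operator `A` (by convention `0` if `A` is
not a bijection of its domain onto `H` with bounded inverse). -/
def inverse {H : Type*} [NormedAddCommGroup H] [InnerProductSpace ℂ H]
    (A : H →ₗ.[ℂ] H) : H →L[ℂ] H :=
  if h : ∃ T : H →L[ℂ] H, ∀ x y : H, T y = x ↔ (x, y) ∈ A.graph then h.choose else 0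

/-- The power `A ^ s`, `s ≥ 0`, of a positive definite selfadjoint operator `A`, as an unbounded
operator: it is the inverse of the bounded injective operator `(A⁻¹) ^ s` given by the continuous
functional calculus. Its domain is the range of `(A⁻¹) ^ s`. -/
def pow {H : Type*} [NormedAddCommGroup H] [InnerProductSpace ℂ H] [CompleteSpace H]
    (A : H →ₗ.[ℂ] H) (s : ℝ) : H →ₗ.[ℂ] H :=
  ((inverse A ^ s : H →L[ℂ] H).toLinearMap.toPMap ⊤).inverse

open Classical in
/-- The vector `A ^ s x` for `x` in the domain of `A ^ s` (and `0` for other `x`). -/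
def powApply {H : Type*} [NormedAddCommGroup H] [InnerProductSpace ℂ H] [CompleteSpace H]
    (A : H →ₗ.[ℂ] H) (s : ℝ) (x : H) : H :=
  if h : x ∈ (pow A s).domain then pow A s ⟨x, h⟩ else 0

/-- The norm `‖x‖_s = ‖A ^ s x‖` on the domain of `A ^ s`. -/
def powNorm {H : Type*} [NormedAddCommGroup H] [InnerProductSpace ℂ H] [CompleteSpace H]
    (A : H →ₗ.[ℂ] H) (s : ℝ) (x : H) : ℝ :=
  ‖powApply A s x‖

/-- `x` lies in the eigenspace of `A` for the number `r` (the zero vector included). -/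
def InEigenspace {H : Type*} [NormedAddCommGroup H] [InnerProductSpace ℂ H]
    (A : H →ₗ.[ℂ] H) (r : ℝ) (x : H) : Prop :=
  ∃ h : x ∈ A.domain, A ⟨x, h⟩ = (r : ℂ) • x

/-- `r 0 ≤ r 1 ≤ …` are all the eigenvalues of `A`, counted according to multiplicity, and
`e 0, e 1, …` are corresponding orthonormal eigenvectors: no eigenvector is left out. -/
structure IsEigenEnumeration {H : Type*} [NormedAddCommGroup H] [InnerProductSpace ℂ H]
    (A : H →ₗ.[ℂ] H) (r : ℕ → ℝ) (e : ℕ → H) : Prop where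
  monotone : Monotone r
  orthonormal : Orthonormal ℂ e
  eigen : ∀ k, InEigenspace A (r k) (e k)
  complete : ∀ (s : ℝ) (x : H), InEigenspace A s x →
    x ∈ (Submodule.span ℂ (Set.range e)).topologicalClosure

/-- `D(A ^ s) = D(M ^ s)` with equivalent norms, where the identification `ι` expresses that the
Hilbert spaces `H` and `G` have the same elements and equivalent norms. -/
def SameDomain {H G : Type*} [NormedAddCommGroup H] [InnerProductSpace ℂ H] [CompleteSpace H]
    [NormedAddCommGroup G] [InnerProductSpace ℂ G] [CompleteSpace G]
    (ι : H ≃L[ℂ] G) (A : H →ₗ.[ℂ] H) (M : G →ₗ.[ℂ] G) (s : ℝ) : Prop :=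
  (∀ x : H, x ∈ (pow A s).domain ↔ ι x ∈ (pow M s).domain) ∧
  ∃ c C : ℝ, 0 < c ∧ 0 < C ∧ ∀ x ∈ (pow A s).domain,
    c * powNorm M s (ι x) ≤ powNorm A s x ∧ powNorm A s x ≤ C * powNorm M s (ι x)

/-- `D(M ^ s)` is contained in `D(A ^ s)`, with continuous injection. -/
def ContEmbedded {H G : Type*} [NormedAddCommGroup H] [InnerProductSpace ℂ H] [CompleteSpace H]
    [NormedAddCommGroup G] [InnerProductSpace ℂ G] [CompleteSpace G]
    (ι : H ≃L[ℂ] G) (A : H →ₗ.[ℂ] H) (M : G →ₗ.[ℂ] G) (s : ℝ) : Prop :=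
  ∃ C : ℝ, ∀ x : H, ι x ∈ (pow M s).domain →
    x ∈ (pow A s).domain ∧ powNorm A s x ≤ C * powNorm M s (ι x)

/-- The matrix `[a(w i, w j)]` of the energy form `a(x, y) = ⟨A ^ (1/2) x, A ^ (1/2) y⟩`. -/
def stiffness {H : Type*} [NormedAddCommGroup H] [InnerProductSpace ℂ H] [CompleteSpace H]
    (A : H →ₗ.[ℂ] H) (w : ℕ → H) (n : ℕ) : Matrix (Fin n) (Fin n) ℂ :=
  Matrix.of fun i j => inner ℂ (powApply A (1 / 2) (w i)) (powApply A (1 / 2) (w j))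

/-- The matrix `[⟨w i, w j⟩]`. -/
def mass {H : Type*} [NormedAddCommGroup H] [InnerProductSpace ℂ H]
    (w : ℕ → H) (n : ℕ) : Matrix (Fin n) (Fin n) ℂ :=
  Matrix.of fun i j => inner ℂ (w i) (w j)

/-- `(L j, v j)`, `j < n`, are the regular Rayleigh-Ritz eigenpairs of `A` for the trial vectors
`w 0, …, w (n - 1)`: the `L j` are in increasing order, the `v j` are orthonormal in `H`, and
`v j = ∑ i, x i • w i` for a solution `x` of `[a(w i, w j)] x = L j [⟨w i, w j⟩] x`. Values at
indices `j ≥ n` are irrelevant. -/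
structure IsRayleighRitz {H : Type*} [NormedAddCommGroup H] [InnerProductSpace ℂ H]
    [CompleteSpace H] (A : H →ₗ.[ℂ] H) (w : ℕ → H) (n : ℕ) (L : ℕ → ℝ) (v : ℕ → H) : Prop where
  trial_mem : ∀ i < n, w i ∈ (pow A (1 / 2)).domain
  monotone : ∀ i j, i ≤ j → j < n → L i ≤ L j
  orthonormal : Orthonormal ℂ (fun j : Fin n => v j)
  ritz : ∀ j < n, ∃ x : Fin n → ℂ, v j = ∑ i, x i • w i ∧
    (stiffness A w n).mulVec x = (L j : ℂ) • (mass w n).mulVec x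

end FracRitz

end

/-!
Write `V n` for the span of the first `n` eigenvectors of `M`, `Q n` for the `G`-orthogonal
projection onto it (`truncation`), and call `‖A ^ (1/2) x‖` the energy norm. The rate comes from the
quantity `η n = ∑ k < ℓ, |M ^ τ (1 - Q n) u k|`, which is `o(μ n ^ (τ - σ))` because `u k` lies in
`D(M ^ σ)`; it is shown that the error in the norm `‖·‖_τ` is `O(η n)`.

* Since `D(M ^ τ) = D(A ^ τ)`, compactness passes from the inverse of `M` to that of `A`, so that
  the `u k` form a Hilbert basis and all norms can be computed in coordinates.
* Interpolating between the norm of `H` and `‖·‖_τ`, the vectors `(1 - Q n) u k` have energy norm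
  `O(μ n ^ (1/2 - τ) η n)` (`SameDomain.exists_direct_estimate`).
* The classical Rayleigh-Ritz argument, run with trial vectors that approximate the first `ℓ`
  eigenvectors up to an energy error `e`, gives `0 ≤ Λ j - λ j = O(e²)` and from this an energy
  distance `O(e)` between the Ritz vector and its component in the `λ j`-eigenspace
  (`IsEigenEnumeration.exists_ritzVector_error`). This component, normalized, is the eigenvector
  with which the Ritz vector is compared.
* On `V n` the inverse estimate `‖x‖_τ ≤ K μ n ^ (τ - 1/2) ‖A ^ (1/2) x‖` holds
  (`SameDomain.exists_inverse_estimate`). Applied to `Q n w - v`, for the eigenvector `w` and the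
  Ritz vector `v`, it returns exactly the power of `μ n` gained in the energy norm, while `w - Q n w`
  is estimated directly (`SameDomain.exists_ritz_error_bound`).

This route through the inverse estimate needs only the equivalence of the norms of order `τ`.
If the eigenvalue is simple and the Ritz vectors are oriented, the normalized component is `u j`
itself.
-/

namespace FracRitz

/-! ### Powers of positive operators on eigenvectors -/

section Powers

variable {H : Type*} [NormedAddCommGroup H] [InnerProductSpace ℂ H] [CompleteSpace H]

/-- The continuous functional calculus acts on an eigenvector of `T` for `κ` as multiplication by
the value of the function at `κ`: this holds for polynomials and passes to uniform limits. -/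
theorem cfc_apply_eigenvector {T : H →L[ℂ] H} (hT : IsSelfAdjoint T) {κ : ℝ} {x : H}
    (hx : T x = (κ : ℂ) • x) {f : ℝ → ℝ} (hf : Continuous f) :
    cfc f T x = ((f κ : ℝ) : ℂ) • x := by
  rcases eq_or_ne x 0 with rfl | hx0
  · simp
  have hκ : κ ∈ spectrum ℝ T := by
    intro hu
    obtain ⟨U, hU⟩ := hu
    have h1 : (U : H →L[ℂ] H) x = 0 := by
      rw [hU, sub_apply, hx, Algebra.algebraMap_eq_smul_one]
      simp
    have h2 : ((↑U⁻¹ : H →L[ℂ] H) * (U : H →L[ℂ] H)) x = 0 := by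
      rw [mul_apply_eq_comp, h1, map_zero]
    rw [Units.inv_mul] at h2
    exact hx0 h2
  have key : ∀ g : C(spectrum ℝ T, ℝ), cfcHom hT g x = ((g ⟨κ, hκ⟩ : ℝ) : ℂ) • x := by
    intro g
    induction g using ContinuousMap.induction_on_of_compact with
    | const r =>
      have : (ContinuousMap.const (spectrum ℝ T) r) = algebraMap ℝ _ r := rfl
      rw [this, AlgHomClass.commutes, Algebra.algebraMap_eq_smul_one]
      simp
    | id => rw [cfcHom_id hT, hx]; rfl
    | star_id => rw [map_star, cfcHom_id hT, hT.star_eq, hx]; rfl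
    | add f g hf hg => rw [map_add, add_apply, hf, hg, ← add_smul]; simp
    | mul f g hf hg =>
      rw [map_mul, mul_apply_eq_comp, hg, map_smul, hf, smul_smul]
      simp [mul_comm]
    | frequently f hf =>
      have hcl : IsClosed {g : C(spectrum ℝ T, ℝ) |
          cfcHom hT g x = ((g ⟨κ, hκ⟩ : ℝ) : ℂ) • x} := by
        refine isClosed_eq ?_ ?_
        · exact (ContinuousLinearMap.apply ℂ H x).continuous.comp (cfcHom_continuous hT)
        · exact (Complex.continuous_ofReal.comp (continuous_eval_const _)).smul
            continuous_const
      exact hcl.closure_subset_iff.mpr subset_rfl (mem_closure_iff_frequently.mpr hf)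
  rw [cfc_apply f T hT hf.continuousOn, key]
  rfl

theorem rpow_apply_eigenvector {T : H →L[ℂ] H} (hT : 0 ≤ T) {κ : ℝ} {x : H}
    (hx : T x = (κ : ℂ) • x) {s : ℝ} (hs : 0 ≤ s) :
    (T ^ s) x = ((κ ^ s : ℝ) : ℂ) • x := by
  rw [CFC.rpow_eq_cfc_real]
  exact cfc_apply_eigenvector (IsSelfAdjoint.of_nonneg hT) hx (Real.continuous_rpow_const hs)

end Powers

/-! ### The bounded inverse -/

section Positivity

variable {H : Type*} [NormedAddCommGroup H] [InnerProductSpace ℂ H] {A : H →ₗ.[ℂ] H}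

theorem InEigenspace.pos (hpos : IsPositiveDefinite A) {r : ℝ} {x : H}
    (hx : InEigenspace A r x) (hx0 : x ≠ 0) : 0 < r := by
  obtain ⟨h, hr⟩ := hx
  obtain ⟨α, hα, hle⟩ := hpos
  have h1 := hle ⟨x, h⟩
  rw [hr, inner_smul_right, inner_self_eq_norm_sq_to_K] at h1
  have h2 : 0 < ‖x‖ ^ 2 := by positivity
  have h3 : ((r : ℂ) * ((‖x‖ : ℂ)) ^ 2).re = r * ‖x‖ ^ 2 := by
    norm_cast
  simp only [Complex.coe_algebraMap] at h1
  rw [h3] at h1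
  nlinarith

theorem IsEigenEnumeration.pos (hpos : IsPositiveDefinite A) {r : ℕ → ℝ} {e : ℕ → H}
    (he : IsEigenEnumeration A r e) (k : ℕ) : 0 < r k :=
  (he.eigen k).pos hpos (he.orthonormal.ne_zero k)

end Positivity

section Inverse

variable {H : Type*} [NormedAddCommGroup H] [InnerProductSpace ℂ H] [CompleteSpace H]
  {A : H →ₗ.[ℂ] H}

theorem inverse_apply_eq_iff (hA : IsSelfAdjoint A) (hpos : IsPositiveDefinite A) (x y : H) :
    inverse A y = x ↔ (x, y) ∈ A.graph := by
  have h := exists_bounded_inverse A hA hpos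
  rw [inverse, dif_pos h]
  exact h.choose_spec x y

theorem exists_domain_inverse_eq (hA : IsSelfAdjoint A) (hpos : IsPositiveDefinite A) (y : H) :
    ∃ x : A.domain, (x : H) = inverse A y ∧ A x = y :=
  (LinearPMap.mem_graph_iff A).mp ((inverse_apply_eq_iff hA hpos _ y).mp rfl)

theorem inverse_nonneg (hA : IsSelfAdjoint A) (hpos : IsPositiveDefinite A) :
    0 ≤ inverse A := by
  rw [ContinuousLinearMap.nonneg_iff_isPositive, ContinuousLinearMap.isPositive_iff]
  have hformal : ∀ x y : A.domain, inner ℂ (A x) (y : H) = inner ℂ (x : H) (A y) := by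
    have h := LinearPMap.adjoint_isFormalAdjoint (T := A) hA.dense_domain
    rw [show LinearPMap.adjoint A = A from hA] at h
    exact fun x y => h x y
  refine ⟨fun y z => ?_, fun y => ?_⟩
  · obtain ⟨x, hx, hxy⟩ := exists_domain_inverse_eq hA hpos y
    obtain ⟨w, hw, hwz⟩ := exists_domain_inverse_eq hA hpos z
    have h := hformal x w
    rw [hxy, hwz, hx, hw] at h
    exact h.symm
  · obtain ⟨x, hx, hxy⟩ := exists_domain_inverse_eq hA hpos y
    obtain ⟨α, hα, hle⟩ := hpos
    have h := hle x
    have h2 := hformal x x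
    rw [hxy, hx] at h h2
    have h3 : 0 ≤ (inner ℂ (inverse A y) y).re := le_trans (by positivity) h
    have h4 : inner ℂ (inverse A y) y = starRingEnd ℂ (inner ℂ (inverse A y) y) := by
      rw [inner_conj_symm]; exact h2.symm
    exact (Complex.nonneg_iff).mpr ⟨h3, (Complex.conj_eq_iff_im.mp h4.symm).symm⟩

theorem eq_zero_of_inverse_eq_zero (hA : IsSelfAdjoint A) (hpos : IsPositiveDefinite A) {y : H}
    (hy : inverse A y = 0) : y = 0 := by
  obtain ⟨x, hx, hxy⟩ := exists_domain_inverse_eq hA hpos y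
  rw [hy] at hx
  rw [← hxy, show x = 0 from Subtype.ext hx, A.map_zero]

theorem InEigenspace.inverse_apply (hA : IsSelfAdjoint A) (hpos : IsPositiveDefinite A)
    {r : ℝ} (hr0 : r ≠ 0) {x : H} (hx : InEigenspace A r x) :
    inverse A x = ((r⁻¹ : ℝ) : ℂ) • x := by
  obtain ⟨h, hr⟩ := hx
  have h1 : inverse A ((r : ℂ) • x) = x := by
    rw [inverse_apply_eq_iff hA hpos, ← hr]
    exact A.mem_graph ⟨x, h⟩
  rw [map_smul] at h1
  nth_rewrite 2 [← h1]
  rw [smul_smul]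
  have : (r : ℂ) ≠ 0 := by exact_mod_cast hr0
  push_cast
  rw [inv_mul_cancel₀ this, one_smul]

theorem inEigenspace_of_inverse_apply (hA : IsSelfAdjoint A) (hpos : IsPositiveDefinite A)
    {κ : ℝ} (hκ : κ ≠ 0) {x : H} (hx : inverse A x = (κ : ℂ) • x) :
    InEigenspace A κ⁻¹ x := by
  have h1 : inverse A (((κ⁻¹ : ℝ) : ℂ) • x) = x := by
    rw [map_smul, hx, smul_smul]
    have : (κ : ℂ) ≠ 0 := by exact_mod_cast hκ
    push_cast
    rw [inv_mul_cancel₀ this, one_smul]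
  rw [inverse_apply_eq_iff hA hpos] at h1
  obtain ⟨z, hz, hz'⟩ := (LinearPMap.mem_graph_iff A).mp h1
  simp only at hz hz'
  subst hz
  exact ⟨z.2, hz'⟩

theorem IsEigenEnumeration.rpow_inverse_apply (hA : IsSelfAdjoint A) (hpos : IsPositiveDefinite A)
    {r : ℕ → ℝ} {e : ℕ → H} (he : IsEigenEnumeration A r e) {s : ℝ} (hs : 0 ≤ s) (k : ℕ) :
    (inverse A ^ s) (e k) = ((r k ^ (-s) : ℝ) : ℂ) • e k := by
  have hk := he.pos hpos k
  rw [rpow_apply_eigenvector (inverse_nonneg hA hpos)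
    ((he.eigen k).inverse_apply hA hpos hk.ne') hs, Real.inv_rpow hk.le, Real.rpow_neg hk.le]

theorem inner_rpow_left (T : H →L[ℂ] H) (s : ℝ) (x y : H) :
    inner ℂ ((T ^ s) x) y = inner ℂ x ((T ^ s) y) :=
  ((ContinuousLinearMap.nonneg_iff_isPositive _).mp
    (CFC.rpow_nonneg (a := T) (y := s))).inner_left_eq_inner_right x y

theorem IsEigenEnumeration.inner_rpow_inverse (hA : IsSelfAdjoint A) (hpos : IsPositiveDefinite A)
    {r : ℕ → ℝ} {e : ℕ → H} (he : IsEigenEnumeration A r e) {s : ℝ} (hs : 0 ≤ s) (k : ℕ) (y : H) :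
    inner ℂ (e k) ((inverse A ^ s) y) = ((r k ^ (-s) : ℝ) : ℂ) * inner ℂ (e k) y := by
  rw [← inner_rpow_left, he.rpow_inverse_apply hA hpos hs, inner_smul_left, Complex.conj_ofReal]

theorem rpow_rpow_inv_inverse (hA : IsSelfAdjoint A) (hpos : IsPositiveDefinite A) {s : ℝ}
    (hs : 0 < s) : (inverse A ^ s) ^ s⁻¹ = inverse A := by
  rw [CFC.rpow_rpow_of_exponent_nonneg (inverse A) s s⁻¹ hs.le (inv_nonneg.mpr hs.le)
    (inverse_nonneg hA hpos), mul_inv_cancel₀ hs.ne', CFC.rpow_one _ (inverse_nonneg hA hpos)]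

theorem eq_zero_of_rpow_inverse_eq_zero (hA : IsSelfAdjoint A) (hpos : IsPositiveDefinite A)
    {s : ℝ} (hs : 0 ≤ s) {x : H} (hx : (inverse A ^ s) x = 0) : x = 0 := by
  rcases hs.eq_or_lt with rfl | hs
  · rwa [CFC.rpow_zero _ (inverse_nonneg hA hpos)] at hx
  have h := rpow_apply_eigenvector (T := inverse A ^ s) CFC.rpow_nonneg (κ := 0) (x := x)
    (by rw [hx]; simp) (inv_nonneg.mpr hs.le)
  rw [rpow_rpow_inv_inverse hA hpos hs, Real.zero_rpow (inv_ne_zero hs.ne')] at h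
  exact eq_zero_of_inverse_eq_zero hA hpos (by rw [h]; simp)

open scoped ComplexOrder in
/-- If some power of the inverse is compact, the eigenvectors of `A` are complete. The spectral
theorem gives a complete set of eigenvectors of the compact power, and these are eigenvectors of
`A⁻¹` because `A⁻¹` is in turn a power of that operator. -/
theorem IsEigenEnumeration.orthogonal_eq_bot (hA : IsSelfAdjoint A) (hpos : IsPositiveDefinite A)
    {r : ℕ → ℝ} {e : ℕ → H} (he : IsEigenEnumeration A r e) {s : ℝ} (hs : 0 < s)
    (hcpt : IsCompactOperator (inverse A ^ s : H →L[ℂ] H)) :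
    (Submodule.span ℂ (Set.range e))ᗮ = ⊥ := by
  have hS0 : 0 ≤ inverse A ^ s := CFC.rpow_nonneg
  have hSpos := (ContinuousLinearMap.nonneg_iff_isPositive _).mp hS0
  have hback := rpow_rpow_inv_inverse hA hpos hs
  have hspec := ContinuousLinearMap.orthogonalComplement_iSup_eigenspaces_eq_bot hcpt
    hSpos.isSymmetric
  have hle : (⨆ κ, Module.End.eigenspace ((inverse A ^ s : H →L[ℂ] H) : Module.End ℂ H) κ)
      ≤ (Submodule.span ℂ (Set.range e)).topologicalClosure := by
    refine iSup_le fun κ x hx => ?_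
    rw [Module.End.mem_eigenspace_iff] at hx
    change (inverse A ^ s) x = κ • x at hx
    rcases eq_or_ne x 0 with rfl | hx0
    · exact zero_mem _
    have h1 := hSpos.inner_nonneg_right x
    rw [hx, inner_smul_right, inner_self_eq_norm_sq_to_K] at h1
    have h2 : (0 : ℝ) < ‖x‖ ^ 2 := by positivity
    have h3 : 0 ≤ κ := by
      have h4 : ((‖x‖ : ℂ)) ^ 2 = ((‖x‖ ^ 2 : ℝ) : ℂ) := by push_cast; rfl
      simp only [Complex.coe_algebraMap] at h1
      rw [h4, Complex.nonneg_iff] at h1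
      rw [Complex.re_mul_ofReal, Complex.im_mul_ofReal] at h1
      refine Complex.nonneg_iff.mpr ⟨?_, ?_⟩
      · exact nonneg_of_mul_nonneg_left h1.1 h2
      · have := h1.2
        rcases mul_eq_zero.mp this.symm with h | h
        · exact h.symm
        · exact absurd h h2.ne'
    have hκ : κ = ((κ.re : ℝ) : ℂ) := Complex.eq_re_of_ofReal_le h3
    have hκ0 : κ ≠ 0 := by
      rintro rfl
      exact hx0 (eq_zero_of_rpow_inverse_eq_zero hA hpos hs.le (by rw [hx, zero_smul]))
    have hre : κ.re ≠ 0 := fun h => hκ0 (by rw [hκ, h]; simp)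
    rw [hκ] at hx
    have hT := rpow_apply_eigenvector hS0 hx (inv_nonneg.mpr hs.le)
    rw [hback] at hT
    have hre0 : 0 < κ.re := lt_of_le_of_ne (Complex.nonneg_iff.mp h3).1 hre.symm
    exact he.complete _ x (inEigenspace_of_inverse_apply hA hpos
      (Real.rpow_pos_of_pos hre0 _).ne' hT)
  rw [eq_bot_iff, ← hspec, ← Submodule.orthogonal_closure]
  exact Submodule.orthogonal_le hle

/-- The Hilbert basis formed by the eigenvectors, once they are known to be complete. -/
theorem IsEigenEnumeration.exists_hilbertBasis {r : ℕ → ℝ} {e : ℕ → H}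
    (he : IsEigenEnumeration A r e) (h : (Submodule.span ℂ (Set.range e))ᗮ = ⊥) :
    ∃ b : HilbertBasis ℕ ℂ H, ∀ k, b k = e k :=
  ⟨HilbertBasis.mkOfOrthogonalEqBot he.orthonormal h, fun k => by simp⟩

theorem IsEigenEnumeration.exists_hilbertBasis_of_isCompactOperator (hA : IsSelfAdjoint A)
    (hpos : IsPositiveDefinite A) (hcpt : IsCompactOperator (inverse A)) {r : ℕ → ℝ} {e : ℕ → H}
    (he : IsEigenEnumeration A r e) : ∃ b : HilbertBasis ℕ ℂ H, ∀ k, b k = e k := by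
  have h1 : inverse A ^ (1 : ℝ) = inverse A := CFC.rpow_one _ (inverse_nonneg hA hpos)
  exact he.exists_hilbertBasis (he.orthogonal_eq_bot hA hpos one_pos (by rwa [h1]))

end Inverse

/-! ### Powers in eigenvector coordinates -/

section HilbertBasis

variable {H : Type*} [NormedAddCommGroup H] [InnerProductSpace ℂ H] (b : HilbertBasis ℕ ℂ H)

theorem hasSum_sq_norm_inner (x : H) : HasSum (fun k => ‖inner ℂ (b k) x‖ ^ 2) (‖x‖ ^ 2) := by
  have h := (b.hasSum_inner_mul_inner x x).mapL Complex.reCLM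
  convert h using 1
  · ext k
    rw [← inner_conj_symm x (b k), ← Complex.normSq_eq_conj_mul_self, Complex.normSq_eq_norm_sq]
    exact (Complex.ofReal_re _).symm
  · rw [inner_self_eq_norm_sq_to_K]
    simp [← Complex.ofReal_pow]

theorem eq_of_forall_inner_eq {x y : H} (h : ∀ k, inner ℂ (b k) x = inner ℂ (b k) y) : x = y := by
  have h1 := hasSum_sq_norm_inner b (x - y)
  have h2 : (fun k => ‖inner ℂ (b k) (x - y)‖ ^ 2) = fun _ => 0 := by
    ext k; simp [h k]
  rw [h2] at h1
  have h3 := h1.unique hasSum_zero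
  exact sub_eq_zero.mp (norm_eq_zero.mp (pow_eq_zero_iff two_ne_zero |>.mp h3))

theorem exists_forall_inner_eq {c : ℕ → ℂ} (hc : Summable fun k => ‖c k‖ ^ 2) :
    ∃ x : H, ∀ k, inner ℂ (b k) x = c k := by
  have hmem : Memℓp c 2 := by
    refine memℓp_gen ?_
    simpa using hc
  refine ⟨b.repr.symm ⟨c, hmem⟩, fun k => ?_⟩
  rw [← b.repr_apply_apply, LinearIsometryEquiv.apply_symm_apply]

/-- The orthogonal projection of `x` onto the span of `b 0, …, b (n - 1)`. -/
noncomputable def truncation (n : ℕ) (x : H) : H := ∑ k ∈ Finset.range n, inner ℂ (b k) x • b k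

theorem inner_truncation (n : ℕ) (x : H) (k : ℕ) :
    inner ℂ (b k) (truncation b n x) = if k < n then inner ℂ (b k) x else 0 := by
  rw [truncation, inner_sum]
  simp only [inner_smul_right, orthonormal_iff_ite.mp b.orthonormal]
  simp

theorem inner_sub_truncation (n : ℕ) (x : H) (k : ℕ) :
    inner ℂ (b k) (x - truncation b n x) = if k < n then 0 else inner ℂ (b k) x := by
  rw [inner_sub_right, inner_truncation]
  split_ifs <;> simp

theorem tendsto_norm_sub_truncation (x : H) :
    Tendsto (fun n => ‖x - truncation b n x‖) atTop (𝓝 0) := by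
  have h := (b.hasSum_repr x).tendsto_sum_nat
  simp only [b.repr_apply_apply] at h
  have h2 := (tendsto_const_nhds (x := x)).sub h
  rw [sub_self] at h2
  simpa [truncation] using h2.norm

theorem truncation_add (n : ℕ) (x y : H) :
    truncation b n (x + y) = truncation b n x + truncation b n y := by
  simp [truncation, add_smul, Finset.sum_add_distrib]

theorem truncation_eq_self {n : ℕ} {x : H}
    (hx : x ∈ Submodule.span ℂ (b '' {k | k < n})) : truncation b n x = x := by
  induction hx using Submodule.span_induction with
  | mem x hx =>
    obtain ⟨k, hk, rfl⟩ := hx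
    refine eq_of_forall_inner_eq b fun i => ?_
    rw [inner_truncation, orthonormal_iff_ite.mp b.orthonormal]
    have hk' : k < n := hk
    split_ifs <;> first | rfl | omega
  | zero => simp [truncation]
  | add x y _ _ hx hy => rw [truncation_add, hx, hy]
  | smul c x _ hx =>
    nth_rewrite 2 [← hx]
    simp [truncation, Finset.smul_sum, smul_smul]

end HilbertBasis

section Coordinates

variable {H : Type*} [NormedAddCommGroup H] [InnerProductSpace ℂ H] [CompleteSpace H]
  {A : H →ₗ.[ℂ] H}

theorem mem_pow_domain_iff_exists (s : ℝ) (x : H) :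
    x ∈ (pow A s).domain ↔ ∃ y, (inverse A ^ s) y = x := by
  rw [pow, LinearPMap.inverse_domain]
  constructor
  · rintro ⟨y, hy⟩
    exact ⟨y, hy⟩
  · rintro ⟨y, hy⟩
    exact ⟨⟨y, trivial⟩, hy⟩

theorem powApply_eq {s : ℝ} {x : H} (hx : x ∈ (pow A s).domain) :
    powApply A s x = pow A s ⟨x, hx⟩ := dif_pos hx

theorem powApply_rpow_inverse (hA : IsSelfAdjoint A) (hpos : IsPositiveDefinite A) {s : ℝ}
    (hs : 0 ≤ s) (y : H) : powApply A s ((inverse A ^ s) y) = y := by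
  have hx : (inverse A ^ s) y ∈ (pow A s).domain := (mem_pow_domain_iff_exists s _).mpr ⟨y, rfl⟩
  rw [powApply_eq hx]
  refine LinearPMap.inverse_apply_eq (f := (inverse A ^ s : H →L[ℂ] H).toLinearMap.toPMap ⊤) ?_
    (y := ⟨_, hx⟩) (x := ⟨y, trivial⟩) rfl
  rw [LinearMap.ker_eq_bot']
  intro m hm
  exact Subtype.ext (eq_zero_of_rpow_inverse_eq_zero hA hpos hs hm)

theorem powNorm_nonneg (s : ℝ) (x : H) : 0 ≤ powNorm A s x := norm_nonneg _

theorem powApply_add {s : ℝ} {x y : H} (hx : x ∈ (pow A s).domain) (hy : y ∈ (pow A s).domain) :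
    powApply A s (x + y) = powApply A s x + powApply A s y := by
  rw [powApply_eq hx, powApply_eq hy, powApply_eq (Submodule.add_mem _ hx hy)]
  exact (pow A s).map_add ⟨x, hx⟩ ⟨y, hy⟩

theorem powApply_smul {s : ℝ} {x : H} (hx : x ∈ (pow A s).domain) (c : ℂ) :
    powApply A s (c • x) = c • powApply A s x := by
  rw [powApply_eq hx, powApply_eq (Submodule.smul_mem _ c hx)]
  exact (pow A s).map_smul c ⟨x, hx⟩

theorem powApply_sub {s : ℝ} {x y : H} (hx : x ∈ (pow A s).domain) (hy : y ∈ (pow A s).domain) :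
    powApply A s (x - y) = powApply A s x - powApply A s y := by
  rw [powApply_eq hx, powApply_eq hy, powApply_eq (Submodule.sub_mem _ hx hy)]
  exact (pow A s).map_sub ⟨x, hx⟩ ⟨y, hy⟩

theorem powApply_sum_smul {s : ℝ} {ι : Type*} (F : Finset ι) {x : ι → H}
    (hx : ∀ i ∈ F, x i ∈ (pow A s).domain) (c : ι → ℂ) :
    powApply A s (∑ i ∈ F, c i • x i) = ∑ i ∈ F, c i • powApply A s (x i) := by
  classical
  induction F using Finset.induction_on with
  | empty => simpa using powApply_smul (A := A) (s := s) (zero_mem _) (0 : ℂ)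
  | insert i F hi ih =>
    have hx' : ∀ j ∈ F, x j ∈ (pow A s).domain := fun j hj => hx j (Finset.mem_insert_of_mem hj)
    have hxi := hx i (Finset.mem_insert_self _ _)
    rw [Finset.sum_insert hi, Finset.sum_insert hi, powApply_add (Submodule.smul_mem _ _ hxi)
      (Submodule.sum_mem _ fun j hj => Submodule.smul_mem _ _ (hx' j hj)), powApply_smul hxi,
      ih hx']

theorem powNorm_sub_le {s : ℝ} {x y : H} (hx : x ∈ (pow A s).domain) (hy : y ∈ (pow A s).domain) :
    powNorm A s (x - y) ≤ powNorm A s x + powNorm A s y := by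
  rw [powNorm, powApply_sub hx hy]
  exact norm_sub_le _ _

theorem powNorm_add_le {s : ℝ} {x y : H} (hx : x ∈ (pow A s).domain) (hy : y ∈ (pow A s).domain) :
    powNorm A s (x + y) ≤ powNorm A s x + powNorm A s y := by
  rw [powNorm, powApply_add hx hy]
  exact norm_add_le _ _

theorem powNorm_smul {s : ℝ} {x : H} (hx : x ∈ (pow A s).domain) (c : ℂ) :
    powNorm A s (c • x) = ‖c‖ * powNorm A s x := by
  rw [powNorm, powApply_smul hx, norm_smul, powNorm]

theorem powNorm_sum_smul_le {s : ℝ} {ι : Type*} (F : Finset ι) {x : ι → H}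
    (hx : ∀ i ∈ F, x i ∈ (pow A s).domain) (c : ι → ℂ) :
    powNorm A s (∑ i ∈ F, c i • x i) ≤ ∑ i ∈ F, ‖c i‖ * powNorm A s (x i) := by
  rw [powNorm, powApply_sum_smul F hx]
  refine (norm_sum_le _ _).trans (Finset.sum_le_sum fun i _ => ?_)
  rw [norm_smul, powNorm]

variable {r : ℕ → ℝ} {b : HilbertBasis ℕ ℂ H}

theorem IsEigenEnumeration.inner_powApply (hA : IsSelfAdjoint A) (hpos : IsPositiveDefinite A)
    (he : IsEigenEnumeration A r b) {s : ℝ} (hs : 0 ≤ s) {x : H}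
    (hx : x ∈ (pow A s).domain) (k : ℕ) :
    inner ℂ (b k) (powApply A s x) = ((r k ^ s : ℝ) : ℂ) * inner ℂ (b k) x := by
  obtain ⟨y, rfl⟩ := (mem_pow_domain_iff_exists s x).mp hx
  have hk := he.pos hpos k
  rw [powApply_rpow_inverse hA hpos hs, he.inner_rpow_inverse hA hpos hs, ← mul_assoc,
    ← Complex.ofReal_mul, ← Real.rpow_add hk]
  simp

theorem IsEigenEnumeration.hasSum_powNorm_sq (hA : IsSelfAdjoint A) (hpos : IsPositiveDefinite A)
    (he : IsEigenEnumeration A r b) {s : ℝ} (hs : 0 ≤ s) {x : H} (hx : x ∈ (pow A s).domain) :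
    HasSum (fun k => (r k ^ s * ‖inner ℂ (b k) x‖) ^ 2) (powNorm A s x ^ 2) := by
  have h := hasSum_sq_norm_inner b (powApply A s x)
  rw [powNorm]
  convert h using 3 with k
  rw [he.inner_powApply hA hpos hs hx, norm_mul, Complex.norm_real, Real.norm_of_nonneg
    (Real.rpow_nonneg (he.pos hpos k).le _)]

theorem IsEigenEnumeration.mem_pow_domain (hA : IsSelfAdjoint A) (hpos : IsPositiveDefinite A)
    (he : IsEigenEnumeration A r b) {s : ℝ} (hs : 0 ≤ s) {x : H}
    (hx : Summable fun k => (r k ^ s * ‖inner ℂ (b k) x‖) ^ 2) : x ∈ (pow A s).domain := by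
  obtain ⟨y, hy⟩ := exists_forall_inner_eq b
    (c := fun k => ((r k ^ s : ℝ) : ℂ) * inner ℂ (b k) x) (by
      convert hx using 3 with k
      rw [norm_mul, Complex.norm_real, Real.norm_of_nonneg
        (Real.rpow_nonneg (he.pos hpos k).le _)])
  refine (mem_pow_domain_iff_exists s x).mpr ⟨y, eq_of_forall_inner_eq b fun k => ?_⟩
  have hk := he.pos hpos k
  rw [he.inner_rpow_inverse hA hpos hs, hy, ← mul_assoc, ← Complex.ofReal_mul, ← Real.rpow_add hk]
  simp

/-- A coordinatewise bound of `A ^ s x` by `A ^ t y` gives membership and a norm bound. -/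
theorem IsEigenEnumeration.powNorm_le (hA : IsSelfAdjoint A) (hpos : IsPositiveDefinite A)
    (he : IsEigenEnumeration A r b) {s t : ℝ} (hs : 0 ≤ s) (ht : 0 ≤ t) {x y : H}
    (hy : y ∈ (pow A t).domain) {C : ℝ} (hC : 0 ≤ C)
    (h : ∀ k, r k ^ s * ‖inner ℂ (b k) x‖ ≤ C * (r k ^ t * ‖inner ℂ (b k) y‖)) :
    x ∈ (pow A s).domain ∧ powNorm A s x ≤ C * powNorm A t y := by
  have h1 := (he.hasSum_powNorm_sq hA hpos ht hy).mul_left (C ^ 2)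
  have h2 : ∀ k, (r k ^ s * ‖inner ℂ (b k) x‖) ^ 2
      ≤ C ^ 2 * (r k ^ t * ‖inner ℂ (b k) y‖) ^ 2 := fun k => by
    rw [← mul_pow]
    have := Real.rpow_nonneg (he.pos hpos k).le s
    exact pow_le_pow_left₀ (by positivity) (h k) 2
  have hx : x ∈ (pow A s).domain := he.mem_pow_domain hA hpos hs
    (Summable.of_nonneg_of_le (fun k => sq_nonneg _) h2 h1.summable)
  refine ⟨hx, ?_⟩
  have h3 := hasSum_le h2 (he.hasSum_powNorm_sq hA hpos hs hx) h1
  rw [← mul_pow] at h3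
  exact le_of_sq_le_sq h3 (mul_nonneg hC (norm_nonneg _))

theorem mem_pow_domain_zero (hA : IsSelfAdjoint A) (hpos : IsPositiveDefinite A) (x : H) :
    x ∈ (pow A 0).domain :=
  (mem_pow_domain_iff_exists 0 x).mpr
    ⟨x, by rw [CFC.rpow_zero _ (inverse_nonneg hA hpos)]; rfl⟩

theorem powNorm_zero (hA : IsSelfAdjoint A) (hpos : IsPositiveDefinite A) (x : H) :
    powNorm A 0 x = ‖x‖ := by
  have h := powApply_rpow_inverse hA hpos le_rfl x
  rw [CFC.rpow_zero _ (inverse_nonneg hA hpos)] at h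
  rw [powNorm]
  exact congrArg norm h

theorem IsEigenEnumeration.powNorm_le_norm (hA : IsSelfAdjoint A) (hpos : IsPositiveDefinite A)
    (he : IsEigenEnumeration A r b) {s : ℝ} (hs : 0 ≤ s) {x y : H} {C : ℝ} (hC : 0 ≤ C)
    (h : ∀ k, r k ^ s * ‖inner ℂ (b k) x‖ ≤ C * ‖inner ℂ (b k) y‖) :
    x ∈ (pow A s).domain ∧ powNorm A s x ≤ C * ‖y‖ := by
  rw [← powNorm_zero hA hpos y]
  exact he.powNorm_le hA hpos hs le_rfl (mem_pow_domain_zero hA hpos y) hC (by simpa using h)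

theorem IsEigenEnumeration.norm_le_powNorm (hA : IsSelfAdjoint A) (hpos : IsPositiveDefinite A)
    (he : IsEigenEnumeration A r b) {s : ℝ} (hs : 0 ≤ s) {x y : H} (hy : y ∈ (pow A s).domain)
    {C : ℝ} (hC : 0 ≤ C)
    (h : ∀ k, ‖inner ℂ (b k) x‖ ≤ C * (r k ^ s * ‖inner ℂ (b k) y‖)) :
    ‖x‖ ≤ C * powNorm A s y := by
  rw [← powNorm_zero hA hpos x]
  exact (he.powNorm_le hA hpos le_rfl hs hy hC (by simpa using h)).2

theorem IsEigenEnumeration.basis_mem_pow_domain (hA : IsSelfAdjoint A)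
    (hpos : IsPositiveDefinite A) (he : IsEigenEnumeration A r b) {s : ℝ} (hs : 0 ≤ s) (k : ℕ) :
    b k ∈ (pow A s).domain := by
  refine (mem_pow_domain_iff_exists s _).mpr ⟨((r k ^ s : ℝ) : ℂ) • b k, ?_⟩
  rw [map_smul, he.rpow_inverse_apply hA hpos hs, smul_smul, ← Complex.ofReal_mul,
    ← Real.rpow_add (he.pos hpos k)]
  simp

theorem IsEigenEnumeration.truncation_mem_pow_domain (hA : IsSelfAdjoint A)
    (hpos : IsPositiveDefinite A) (he : IsEigenEnumeration A r b) {s : ℝ} (hs : 0 ≤ s) (n : ℕ)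
    (x : H) : truncation b n x ∈ (pow A s).domain :=
  Submodule.sum_mem _ fun k _ =>
    Submodule.smul_mem _ _ (he.basis_mem_pow_domain hA hpos hs k)

/-- The inverse estimate: on the span of the first `n` eigenvectors `A ^ s` is bounded
by `r n ^ s`. -/
theorem IsEigenEnumeration.powNorm_truncation_le (hA : IsSelfAdjoint A)
    (hpos : IsPositiveDefinite A) (he : IsEigenEnumeration A r b) {s : ℝ} (hs : 0 ≤ s) (n : ℕ)
    (x : H) : powNorm A s (truncation b n x) ≤ r n ^ s * ‖x‖ := by
  refine (he.powNorm_le_norm hA hpos hs (Real.rpow_nonneg (he.pos hpos n).le _) fun k => ?_).2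
  rw [inner_truncation]
  split_ifs with hk
  · have := Real.rpow_le_rpow (he.pos hpos k).le (he.monotone hk.le) hs
    gcongr
  · have := Real.rpow_nonneg (he.pos hpos n).le s
    simp only [norm_zero, mul_zero]
    positivity

theorem IsEigenEnumeration.powNorm_truncation_le_powNorm (hA : IsSelfAdjoint A)
    (hpos : IsPositiveDefinite A) (he : IsEigenEnumeration A r b) {s : ℝ} (hs : 0 ≤ s) (n : ℕ)
    {x : H} (hx : x ∈ (pow A s).domain) : powNorm A s (truncation b n x) ≤ powNorm A s x := by
  rw [← one_mul (powNorm A s x)]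
  refine (he.powNorm_le hA hpos hs hs hx zero_le_one fun k => ?_).2
  have := Real.rpow_nonneg (he.pos hpos k).le s
  rw [inner_truncation, one_mul]
  split_ifs
  · exact le_rfl
  · simp only [norm_zero, mul_zero]
    positivity

/-- The direct estimate: cutting off the first `n` coordinates gains a power of `r n`. -/
theorem IsEigenEnumeration.powNorm_sub_truncation_le (hA : IsSelfAdjoint A)
    (hpos : IsPositiveDefinite A) (he : IsEigenEnumeration A r b) {s t : ℝ} (hs : 0 ≤ s)
    (hst : s ≤ t) (n : ℕ) {x : H} (hx : x ∈ (pow A t).domain) :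
    powNorm A s (x - truncation b n x)
      ≤ r n ^ (s - t) * powNorm A t (x - truncation b n x) := by
  refine (he.powNorm_le hA hpos hs (hs.trans hst)
    (Submodule.sub_mem _ hx (he.truncation_mem_pow_domain hA hpos (hs.trans hst) n x))
    (Real.rpow_nonneg (he.pos hpos n).le _) fun k => ?_).2
  rw [inner_sub_truncation]
  split_ifs with hk
  · simp
  · have h1 := Real.rpow_le_rpow_of_nonpos (he.pos hpos n)
      (he.monotone (not_lt.mp hk)) (sub_nonpos.mpr hst)
    have h2 : r k ^ s = r k ^ (s - t) * r k ^ t := by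
      rw [← Real.rpow_add (he.pos hpos k)]; simp
    have h3 := Real.rpow_nonneg (he.pos hpos k).le t
    rw [h2, mul_assoc]
    gcongr

theorem IsEigenEnumeration.tendsto_powNorm_sub_truncation (hA : IsSelfAdjoint A)
    (hpos : IsPositiveDefinite A) (he : IsEigenEnumeration A r b) {s : ℝ} (hs : 0 ≤ s) {x : H}
    (hx : x ∈ (pow A s).domain) :
    Tendsto (fun n => powNorm A s (x - truncation b n x)) atTop (𝓝 0) := by
  refine squeeze_zero (fun n => norm_nonneg _) (fun n => ?_)
    (tendsto_norm_sub_truncation b (powApply A s x))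
  rw [← one_mul ‖_‖]
  refine (he.powNorm_le_norm hA hpos hs zero_le_one fun k => ?_).2
  rw [inner_sub_truncation, inner_sub_truncation]
  split_ifs
  · simp
  · rw [he.inner_powApply hA hpos hs hx, norm_mul, Complex.norm_real, one_mul, Real.norm_of_nonneg
      (Real.rpow_nonneg (he.pos hpos k).le _)]

theorem IsEigenEnumeration.powNorm_sub_truncation_isLittleO (hA : IsSelfAdjoint A)
    (hpos : IsPositiveDefinite A) (he : IsEigenEnumeration A r b) {s t : ℝ} (hs : 0 ≤ s)
    (hst : s ≤ t) {x : H} (hx : x ∈ (pow A t).domain) :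
    (fun n => powNorm A s (x - truncation b n x)) =o[atTop] fun n => r n ^ (s - t) := by
  have h1 : (fun n => powNorm A t (x - truncation b n x)) =o[atTop] fun _ => (1 : ℝ) :=
    (isLittleO_one_iff ℝ).mpr (he.tendsto_powNorm_sub_truncation hA hpos (hs.trans hst) hx)
  have h2 := (isBigO_refl (fun n => r n ^ (s - t)) atTop).mul_isLittleO h1
  simp only [mul_one] at h2
  refine IsBigO.trans_isLittleO (IsBigO.of_bound 1 (Eventually.of_forall fun n => ?_)) h2
  rw [one_mul, Real.norm_of_nonneg (powNorm_nonneg _ _)]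
  exact (he.powNorm_sub_truncation_le hA hpos hs hst n hx).trans (le_abs_self _)

end Coordinates

/-! ### Compactness of the inverse powers -/

section Compactness

variable {G : Type*} [NormedAddCommGroup G] [InnerProductSpace ℂ G] [CompleteSpace G]
  {M : G →ₗ.[ℂ] G} {r : ℕ → ℝ} {b : HilbertBasis ℕ ℂ G}

theorem IsEigenEnumeration.tendsto_atTop (hM : IsSelfAdjoint M) (hpos : IsPositiveDefinite M)
    (he : IsEigenEnumeration M r b) (hcpt : IsCompactOperator (inverse M)) :
    Tendsto r atTop atTop := by
  rcases tendsto_atTop_of_monotone he.monotone with h | ⟨R, hR⟩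
  · exact h
  exfalso
  have hle : ∀ k, r k ≤ R := he.monotone.ge_of_tendsto hR
  have hR0 : 0 < R := (he.pos hpos 0).trans_le (hle 0)
  obtain ⟨K, hK, hsub⟩ := IsCompactOperator.image_closedBall_subset_compact
    (f := (inverse M).toLinearMap) hcpt 1
  have hmem : ∀ k, inverse M (b k) ∈ K := fun k =>
    hsub ⟨b k, by simp [b.orthonormal.norm_eq_one k], rfl⟩
  obtain ⟨y, -, φ, hφ, hlim⟩ := hK.tendsto_subseq hmem
  have hc := hlim.cauchySeq
  rw [Metric.cauchySeq_iff] at hc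
  obtain ⟨N, hN⟩ := hc R⁻¹ (inv_pos.mpr hR0)
  have h1 := hN N le_rfl (N + 1) (Nat.le_succ N)
  rw [dist_eq_norm] at h1
  set k := φ N
  set m := φ (N + 1)
  have hkm : k ≠ m := (hφ (Nat.lt_succ_self N)).ne
  have h2 : inner ℂ (b k) (inverse M (b k) - inverse M (b m)) = (((r k)⁻¹ : ℝ) : ℂ) := by
    rw [inner_sub_right, (he.eigen k).inverse_apply hM hpos (he.pos hpos k).ne',
      (he.eigen m).inverse_apply hM hpos (he.pos hpos m).ne', inner_smul_right, inner_smul_right,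
      orthonormal_iff_ite.mp b.orthonormal, orthonormal_iff_ite.mp b.orthonormal]
    simp [hkm]
  have h3 := norm_inner_le_norm (𝕜 := ℂ) (b k) (inverse M (b k) - inverse M (b m))
  rw [h2, b.orthonormal.norm_eq_one, one_mul, Complex.norm_real, Real.norm_of_nonneg
    (inv_nonneg.mpr (he.pos hpos k).le)] at h3
  have h4 : R⁻¹ ≤ (r k)⁻¹ := inv_anti₀ (he.pos hpos k) (hle k)
  exact absurd (h4.trans h3) (not_le.mpr h1)

/-- All positive powers of a compact inverse are compact, as norm limits of their compositions
with the spectral projections of finite rank. -/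
theorem IsEigenEnumeration.isCompactOperator_rpow (hM : IsSelfAdjoint M)
    (hpos : IsPositiveDefinite M) (he : IsEigenEnumeration M r b)
    (hcpt : IsCompactOperator (inverse M)) {s : ℝ} (hs : 0 < s) :
    IsCompactOperator (inverse M ^ s : G →L[ℂ] G) := by
  set S : G →L[ℂ] G := inverse M ^ s with hS
  let F : ℕ → G →L[ℂ] G := fun n =>
    ∑ k ∈ Finset.range n, (ContinuousLinearMap.toSpanSingleton ℂ (S (b k))).comp (innerSL ℂ (b k))
  have hF : ∀ n x, F n x = S (truncation b n x) := fun n x => by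
    simp [F, truncation]
  have hFc : ∀ n, IsCompactOperator (F n) := by
    intro n
    refine Submodule.sum_mem (compactOperator (RingHom.id ℂ) G G) fun k _ => ?_
    exact (isCompactOperator_of_locallyCompactSpace_rng
      (ContinuousLinearMap.toSpanSingleton ℂ (S (b k)))).comp_clm (innerSL ℂ (b k))
  refine isCompactOperator_of_tendsto (F := F) (l := atTop) ?_ (Eventually.of_forall hFc)
  rw [tendsto_iff_norm_sub_tendsto_zero]
  have hr : Tendsto (fun n => r n ^ (-s)) atTop (𝓝 0) :=
    (tendsto_rpow_neg_atTop hs).comp (he.tendsto_atTop hM hpos hcpt)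
  refine squeeze_zero (fun n => norm_nonneg _) (fun n => ?_) hr
  refine ContinuousLinearMap.opNorm_le_bound _ (Real.rpow_nonneg (he.pos hpos n).le _) fun x => ?_
  rw [← powNorm_zero hM hpos]
  refine (he.powNorm_le_norm hM hpos le_rfl (Real.rpow_nonneg (he.pos hpos n).le _)
    fun k => ?_).2
  have h0 := Real.rpow_nonneg (he.pos hpos n).le (-s)
  rw [Real.rpow_zero, one_mul, sub_apply, hF, inner_sub_right, hS,
    he.inner_rpow_inverse hM hpos hs.le, he.inner_rpow_inverse hM hpos hs.le, inner_truncation]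
  split_ifs with hk
  · rw [sub_self, norm_zero]
    positivity
  · rw [mul_zero, zero_sub, norm_neg, norm_mul, Complex.norm_real,
      Real.norm_of_nonneg (Real.rpow_nonneg (he.pos hpos k).le _)]
    gcongr ?_ * _
    exact Real.rpow_le_rpow_of_nonpos (he.pos hpos n) (he.monotone (not_lt.mp hk)) (by linarith)

variable {H : Type*} [NormedAddCommGroup H] [InnerProductSpace ℂ H] [CompleteSpace H]
  {A : H →ₗ.[ℂ] H}

/-- Compactness passes from `M ^ (-s)` to `A ^ (-s)`, because `A ^ (-s)` factors as
`ι⁻¹ ∘ M ^ (-s) ∘ B` with the bounded operator `B = M ^ s ∘ ι ∘ A ^ (-s)`. -/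
theorem SameDomain.isCompactOperator_rpow {ι : H ≃L[ℂ] G} (hA : IsSelfAdjoint A)
    (hApos : IsPositiveDefinite A) (hM : IsSelfAdjoint M) (hMpos : IsPositiveDefinite M) {s : ℝ}
    (hs : 0 ≤ s) (hdom : SameDomain ι A M s)
    (hcpt : IsCompactOperator (inverse M ^ s : G →L[ℂ] G)) :
    IsCompactOperator (inverse A ^ s : H →L[ℂ] H) := by
  obtain ⟨hiff, c, C, hc, -, hle⟩ := hdom
  have hmemA : ∀ y, (inverse A ^ s) y ∈ (pow A s).domain := fun y =>
    (mem_pow_domain_iff_exists s _).mpr ⟨y, rfl⟩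
  have hmem : ∀ y, ι ((inverse A ^ s) y) ∈ (pow M s).domain := fun y =>
    (hiff _).mp (hmemA y)
  let L : H →ₗ[ℂ] G :=
    { toFun := fun y => powApply M s (ι ((inverse A ^ s) y))
      map_add' := fun y z => by
        rw [map_add, map_add, powApply_add (hmem y) (hmem z)]
      map_smul' := fun a y => by
        rw [map_smul, map_smul, powApply_smul (hmem y)]; rfl }
  let B : H →L[ℂ] G := L.mkContinuous c⁻¹ fun y => by
    have h := (hle _ (hmemA y)).1
    rw [powNorm, powNorm, powApply_rpow_inverse hA hApos hs] at h
    rw [inv_mul_eq_div, le_div_iff₀ hc, mul_comm]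
    exact h
  have hfac : (inverse A ^ s : H →L[ℂ] H)
      = (ι.symm : G →L[ℂ] H).comp ((inverse M ^ s : G →L[ℂ] G).comp B) := by
    ext y
    obtain ⟨z, hz⟩ := (mem_pow_domain_iff_exists s _).mp (hmem y)
    have hB : B y = z := by
      change powApply M s (ι ((inverse A ^ s) y)) = z
      rw [← hz, powApply_rpow_inverse hM hMpos hs]
    rw [ContinuousLinearMap.comp_apply, ContinuousLinearMap.comp_apply, hB, hz]
    simp
  rw [hfac]
  exact (hcpt.comp_clm B).clm_comp (ι.symm : G →L[ℂ] H)

end Compactness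

/-! ### The Rayleigh-Ritz method -/

section Preliminaries

variable {H : Type*} [NormedAddCommGroup H] [InnerProductSpace ℂ H]

/-- The space spanned by the first `n` trial vectors. -/
def trialSpace (w : ℕ → H) (n : ℕ) : Submodule ℂ H := Submodule.span ℂ (w '' {k | k < n})

/-- Among `j + 1` vectors some nontrivial combination is orthogonal to `j` prescribed vectors. -/
theorem exists_combination_orthogonal (j : ℕ) (p f : ℕ → H) :
    ∃ c : ℕ → ℂ, (∃ k < j + 1, c k ≠ 0) ∧
      ∀ i < j, inner ℂ (f i) (∑ k ∈ Finset.range (j + 1), c k • p k) = 0 := by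
  let Φ : (Fin (j + 1) → ℂ) →ₗ[ℂ] (Fin j → ℂ) :=
    LinearMap.pi fun i => ∑ k : Fin (j + 1), (inner ℂ (f i) (p k)) • LinearMap.proj k
  have hker : LinearMap.ker Φ ≠ ⊥ := LinearMap.ker_ne_bot_of_finrank_lt (by simp)
  obtain ⟨c, hc, hc0⟩ := Submodule.exists_mem_ne_zero_of_ne_bot hker
  refine ⟨fun k => if hk : k < j + 1 then c ⟨k, hk⟩ else 0, ?_, fun i hi => ?_⟩
  · obtain ⟨k, hk⟩ := Function.ne_iff.mp hc0
    exact ⟨k, k.2, by simp only [Fin.is_lt, dif_pos]; exact hk⟩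
  · have h1 := congrFun (LinearMap.mem_ker.mp hc) ⟨i, hi⟩
    simp only [Φ, LinearMap.pi_apply, LinearMap.sum_apply, LinearMap.smul_apply,
      LinearMap.proj_apply, smul_eq_mul, Pi.zero_apply] at h1
    rw [Finset.sum_range, inner_sum]
    refine Eq.trans (Finset.sum_congr rfl fun k _ => ?_) h1
    simp only [Fin.is_lt, dif_pos, inner_smul_right]
    exact mul_comm _ _

/-- The component of `x` in the span of those among `b 0, …, b (ℓ - 1)` that belong to the same
eigenvalue as `b j`. -/
noncomputable def eigenComponent (b : HilbertBasis ℕ ℂ H) (r : ℕ → ℝ) (ℓ j : ℕ) (x : H) : H :=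
  ∑ k ∈ (Finset.range ℓ).filter (fun k => r k = r j), inner ℂ (b k) x • b k

theorem inner_eigenComponent (b : HilbertBasis ℕ ℂ H) (r : ℕ → ℝ) (ℓ j : ℕ) (x : H) (k : ℕ) :
    inner ℂ (b k) (eigenComponent b r ℓ j x)
      = if k < ℓ ∧ r k = r j then inner ℂ (b k) x else 0 := by
  rw [eigenComponent, inner_sum]
  simp only [inner_smul_right, orthonormal_iff_ite.mp b.orthonormal]
  simp

theorem exists_gap {r : ℕ → ℝ} {ℓ j : ℕ} (hj : r j < r ℓ) : ∃ g > 0, r j + 2 * g ≤ r ℓ ∧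
      ∀ k < ℓ, r k ≠ r j → 2 * g ≤ |r k - r j| := by
  have h1 : ∀ᶠ g in 𝓝[>] (0 : ℝ), ∀ k ∈ Finset.range ℓ, r k ≠ r j → 2 * g ≤ |r k - r j| := by
    rw [eventually_all_finset]
    intro k _
    by_cases hk : r k = r j
    · exact Eventually.of_forall fun g h => absurd hk h
    · have : 0 < |r k - r j| / 2 := by have := abs_pos.mpr (sub_ne_zero.mpr hk); positivity
      filter_upwards [Ioo_mem_nhdsGT this] with g hg _
      linarith [hg.2]
  have h2 : 0 < (r ℓ - r j) / 2 := by linarith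
  obtain ⟨g, hg1, hg2⟩ := (h1.and (Ioo_mem_nhdsGT h2)).exists
  exact ⟨g, hg2.1, by linarith [hg2.2], fun k hk => hg1 k (Finset.mem_range.mpr hk)⟩

end Preliminaries

section Ritz

variable {H : Type*} [NormedAddCommGroup H] [InnerProductSpace ℂ H] [CompleteSpace H]
  {A : H →ₗ.[ℂ] H} {w : ℕ → H} {n : ℕ} {L : ℕ → ℝ} {v : ℕ → H}

theorem IsRayleighRitz.trialSpace_le (h : IsRayleighRitz A w n L v) :
    trialSpace w n ≤ (pow A (1 / 2)).domain := by
  rw [trialSpace, Submodule.span_le]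
  rintro _ ⟨i, hi, rfl⟩
  exact h.trial_mem i hi

theorem IsRayleighRitz.mem_trialSpace (h : IsRayleighRitz A w n L v) {j : ℕ} (hj : j < n) :
    v j ∈ trialSpace w n := by
  obtain ⟨x, hx, -⟩ := h.ritz j hj
  rw [hx]
  exact Submodule.sum_mem _ fun i _ =>
    Submodule.smul_mem _ _ (Submodule.subset_span ⟨i, i.2, rfl⟩)

theorem IsRayleighRitz.mem_domain (h : IsRayleighRitz A w n L v) {j : ℕ} (hj : j < n) :
    v j ∈ (pow A (1 / 2)).domain := h.trialSpace_le (h.mem_trialSpace hj)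

/-- The Galerkin equation in weak form. -/
theorem IsRayleighRitz.inner_powApply (h : IsRayleighRitz A w n L v) {j : ℕ} (hj : j < n) {y : H}
    (hy : y ∈ trialSpace w n) :
    inner ℂ (powApply A (1 / 2) y) (powApply A (1 / 2) (v j)) = (L j : ℂ) * inner ℂ y (v j) := by
  have hmem := h.trialSpace_le
  rw [trialSpace] at hy
  induction hy using Submodule.span_induction with
  | mem y hy =>
    obtain ⟨i, hi, rfl⟩ := hy
    obtain ⟨x, hx, hmat⟩ := h.ritz j hj
    have h1 := congrFun hmat ⟨i, hi⟩
    simp only [Matrix.mulVec, dotProduct, stiffness, mass, Matrix.of_apply, Pi.smul_apply,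
      smul_eq_mul] at h1
    rw [hx, powApply_sum_smul Finset.univ (fun (k : Fin n) _ => h.trial_mem k k.2), inner_sum, inner_sum]
    simp only [inner_smul_right]
    simpa only [mul_comm] using h1
  | zero =>
    have h0 := powApply_smul (A := A) (s := 1 / 2) (x := 0) (zero_mem _) 0
    rw [zero_smul, zero_smul] at h0
    rw [h0]; simp
  | add y z hy hz hy' hz' =>
    rw [powApply_add (hmem hy) (hmem hz), inner_add_left, inner_add_left, hy', hz', mul_add]
  | smul c y hy hy' =>
    rw [powApply_smul (hmem hy), inner_smul_left, inner_smul_left, hy']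
    ring

theorem IsRayleighRitz.inner_eq_ite (h : IsRayleighRitz A w n L v) {i j : ℕ} (hi : i < n)
    (hj : j < n) : inner ℂ (v i) (v j) = if i = j then 1 else 0 := by
  have := orthonormal_iff_ite.mp h.orthonormal ⟨i, hi⟩ ⟨j, hj⟩
  simpa [Fin.ext_iff] using this

theorem IsRayleighRitz.sum_inner_smul (h : IsRayleighRitz A w n L v) {y : H}
    (hy : y ∈ trialSpace w n) : ∑ i ∈ Finset.range n, inner ℂ (v i) y • v i = y := by
  have hle : Submodule.span ℂ (Set.range fun j : Fin n => v j) ≤ trialSpace w n := by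
    rw [Submodule.span_le]
    rintro _ ⟨j, rfl⟩
    exact h.mem_trialSpace j.2
  have hfin : {k | k < n}.Finite := Set.finite_lt_nat n
  have : FiniteDimensional ℂ (trialSpace w n) :=
    FiniteDimensional.span_of_finite ℂ (hfin.image w)
  have hrank : Module.finrank ℂ (trialSpace w n)
      ≤ Module.finrank ℂ (Submodule.span ℂ (Set.range fun j : Fin n => v j)) := by
    rw [finrank_span_eq_card h.orthonormal.linearIndependent, Fintype.card_fin]
    classical
    have himg : w '' {k | k < n} = (((Finset.range n).image w : Finset H) : Set H) := by
      ext; simp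
    rw [trialSpace, himg]
    exact (finrank_span_finset_le_card _).trans (Finset.card_image_le.trans (by simp))
  rw [← Submodule.eq_of_le_of_finrank_le hle hrank] at hy
  induction hy using Submodule.span_induction with
  | mem y hy =>
    obtain ⟨j, rfl⟩ := hy
    rw [Finset.sum_congr rfl fun i hi => by
      rw [h.inner_eq_ite (Finset.mem_range.mp hi) j.2, ite_smul, one_smul, zero_smul]]
    simp
  | zero => simp
  | add y z _ _ hy hz =>
    rw [Finset.sum_congr rfl fun i _ => by rw [inner_add_right, add_smul],
      Finset.sum_add_distrib, hy, hz]
  | smul c y _ hy =>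
    nth_rewrite 2 [← hy]
    simp only [inner_smul_right, Finset.smul_sum, smul_smul]

theorem IsRayleighRitz.sum_sq_norm (h : IsRayleighRitz A w n L v) {y : H}
    (hy : y ∈ trialSpace w n) : ∑ i ∈ Finset.range n, ‖inner ℂ (v i) y‖ ^ 2 = ‖y‖ ^ 2 := by
  have h1 : inner ℂ y y = ∑ i ∈ Finset.range n, inner ℂ (v i) y * inner ℂ y (v i) := by
    nth_rewrite 2 [← h.sum_inner_smul hy]
    simp only [inner_sum, inner_smul_right]
  rw [inner_self_eq_norm_sq_to_K] at h1
  simp only [← inner_conj_symm y (v _), Complex.mul_conj, Complex.normSq_eq_norm_sq,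
    Complex.coe_algebraMap] at h1
  exact_mod_cast h1.symm

theorem IsRayleighRitz.sum_mul_sq_norm (h : IsRayleighRitz A w n L v) {y : H}
    (hy : y ∈ trialSpace w n) :
    ∑ i ∈ Finset.range n, L i * ‖inner ℂ (v i) y‖ ^ 2 = powNorm A (1 / 2) y ^ 2 := by
  have h1 : inner ℂ (powApply A (1 / 2) y) (powApply A (1 / 2) y)
      = ∑ i ∈ Finset.range n, (L i : ℂ) * (inner ℂ (v i) y * inner ℂ y (v i)) := by
    nth_rewrite 2 [← h.sum_inner_smul hy]
    rw [powApply_sum_smul _ fun i hi => h.mem_domain (Finset.mem_range.mp hi), inner_sum]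
    refine Finset.sum_congr rfl fun i hi => ?_
    rw [inner_smul_right, h.inner_powApply (Finset.mem_range.mp hi) hy]
    ring
  rw [inner_self_eq_norm_sq_to_K] at h1
  simp only [← inner_conj_symm y (v _), Complex.mul_conj, Complex.normSq_eq_norm_sq,
    Complex.coe_algebraMap] at h1
  rw [powNorm]
  exact_mod_cast h1.symm

variable {r : ℕ → ℝ} {b : HilbertBasis ℕ ℂ H}

theorem IsEigenEnumeration.hasSum_energy (hA : IsSelfAdjoint A) (hpos : IsPositiveDefinite A)
    (he : IsEigenEnumeration A r b) {x : H} (hx : x ∈ (pow A (1 / 2)).domain) :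
    HasSum (fun k => r k * ‖inner ℂ (b k) x‖ ^ 2) (powNorm A (1 / 2) x ^ 2) := by
  convert he.hasSum_powNorm_sq hA hpos (by norm_num) hx using 2 with k
  rw [mul_pow, ← Real.rpow_mul_natCast (he.pos hpos k).le]
  norm_num

theorem IsEigenEnumeration.powApply_basis (hA : IsSelfAdjoint A) (hpos : IsPositiveDefinite A)
    (he : IsEigenEnumeration A r b) {s : ℝ} (hs : 0 ≤ s) (k : ℕ) :
    powApply A s (b k) = ((r k ^ s : ℝ) : ℂ) • b k := by
  refine eq_of_forall_inner_eq b fun i => ?_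
  rw [he.inner_powApply hA hpos hs (he.basis_mem_pow_domain hA hpos hs k), inner_smul_right,
    orthonormal_iff_ite.mp b.orthonormal]
  split_ifs with h
  · rw [h]
  · simp

theorem IsEigenEnumeration.inner_powApply_basis (hA : IsSelfAdjoint A)
    (hpos : IsPositiveDefinite A) (he : IsEigenEnumeration A r b) {x : H}
    (hx : x ∈ (pow A (1 / 2)).domain) (k : ℕ) :
    inner ℂ (powApply A (1 / 2) (b k)) (powApply A (1 / 2) x) = (r k : ℂ) * inner ℂ (b k) x := by
  rw [he.powApply_basis hA hpos (by norm_num), inner_smul_left,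
    he.inner_powApply hA hpos (by norm_num) hx, Complex.conj_ofReal, ← mul_assoc,
    ← Complex.ofReal_mul, ← Real.rpow_add (he.pos hpos k)]
  norm_num

/-- Ritz values bound the eigenvalues from above. -/
theorem IsRayleighRitz.eigenvalue_le (hA : IsSelfAdjoint A) (hpos : IsPositiveDefinite A)
    (he : IsEigenEnumeration A r b) (h : IsRayleighRitz A w n L v) {j : ℕ} (hj : j < n) :
    r j ≤ L j := by
  obtain ⟨c, ⟨k, hk, hck⟩, hc⟩ := exists_combination_orthogonal j v b
  set x := ∑ k ∈ Finset.range (j + 1), c k • v k with hx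
  have hxV : x ∈ trialSpace w n := Submodule.sum_mem _ fun i hi =>
    Submodule.smul_mem _ _ (h.mem_trialSpace (by have := Finset.mem_range.mp hi; omega))
  have hvx : ∀ i < n, inner ℂ (v i) x = if i < j + 1 then c i else 0 := by
    intro i hi
    rw [hx, inner_sum, Finset.sum_congr rfl fun k hk => by
      rw [inner_smul_right, h.inner_eq_ite hi (by have := Finset.mem_range.mp hk; omega)]]
    simp
  have hx0 : x ≠ 0 := by
    intro h0
    have := hvx k (by omega)
    rw [h0, inner_zero_right, if_pos hk] at this
    exact hck this.symm
  have h1 : powNorm A (1 / 2) x ^ 2 ≤ L j * ‖x‖ ^ 2 := by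
    rw [← h.sum_mul_sq_norm hxV, ← h.sum_sq_norm hxV, Finset.mul_sum]
    refine Finset.sum_le_sum fun i hi => ?_
    rw [hvx i (Finset.mem_range.mp hi)]
    split_ifs with hij
    · have := h.monotone i j (by omega) hj
      gcongr
    · simp
  have h2 : r j * ‖x‖ ^ 2 ≤ powNorm A (1 / 2) x ^ 2 := by
    refine hasSum_le (fun k => ?_) ((hasSum_sq_norm_inner b x).mul_left (r j))
      (he.hasSum_energy hA hpos (h.trialSpace_le hxV))
    rcases lt_or_ge k j with hk | hk
    · rw [hc k hk]; simp
    · have := he.monotone hk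
      gcongr
  have h3 : 0 < ‖x‖ ^ 2 := by positivity
  exact le_of_mul_le_mul_right (h2.trans h1) h3

/-- The Poincaré inequality for the energy norm. -/
theorem IsEigenEnumeration.norm_le_energy (hA : IsSelfAdjoint A)
    (hpos : IsPositiveDefinite A) (he : IsEigenEnumeration A r b) {x : H}
    (hx : x ∈ (pow A (1 / 2)).domain) :
    ‖x‖ ≤ r 0 ^ (-(1 / 2) : ℝ) * powNorm A (1 / 2) x := by
  refine he.norm_le_powNorm hA hpos (by norm_num) hx (Real.rpow_nonneg (he.pos hpos 0).le _)
    fun k => ?_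
  rw [← mul_assoc]
  refine le_mul_of_one_le_left (norm_nonneg _) ?_
  have h1 := Real.rpow_le_rpow (he.pos hpos 0).le (he.monotone (Nat.zero_le k))
    (show (0 : ℝ) ≤ 1 / 2 by norm_num)
  have h2 := Real.rpow_pos_of_pos (he.pos hpos 0) (1 / 2)
  rw [Real.rpow_neg (he.pos hpos 0).le, inv_mul_eq_div, le_div_iff₀ h2, one_mul]
  exact h1

/-- The error of a Ritz value is quadratic in the energy error `e` of approximating the
eigenvectors. The min-max test space is spanned by the approximations `p k` of the first
eigenvectors: a combination `x` of these differs from the same combination of eigenvectors by a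
vector `δ` of energy norm `O(e)`, and only the components of `x` beyond the `j`-th, which are
those of `δ`, make the Rayleigh quotient of `x` exceed the eigenvalue. -/
theorem IsRayleighRitz.ritzValue_le (hA : IsSelfAdjoint A) (hpos : IsPositiveDefinite A)
    (he : IsEigenEnumeration A r b) (h : IsRayleighRitz A w n L v) {j : ℕ}
    {p : ℕ → H} {e : ℝ} (hp : ∀ k ≤ j, p k ∈ trialSpace w n)
    (hpe : ∀ k ≤ j, powNorm A (1 / 2) (b k - p k) ≤ e)
    (hsmall : (j + 1) * (r 0 ^ (-(1 / 2) : ℝ) * e) ≤ 1 / 2) :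
    L j ≤ r j + 4 * (j + 1) ^ 2 * e ^ 2 := by
  have he0 : 0 ≤ e := (powNorm_nonneg _ _).trans (hpe 0 (Nat.zero_le j))
  have hκ := Real.rpow_nonneg (he.pos hpos 0).le (-(1 / 2) : ℝ)
  obtain ⟨c, ⟨k₀, hk₀, hck₀⟩, hc⟩ := exists_combination_orthogonal j p v
  have hbD : ∀ k, b k ∈ (pow A (1 / 2)).domain :=
    he.basis_mem_pow_domain hA hpos (by norm_num)
  set x := ∑ k ∈ Finset.range (j + 1), c k • p k with hx
  set y := ∑ k ∈ Finset.range (j + 1), c k • b k with hy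
  set δ := ∑ k ∈ Finset.range (j + 1), c k • (b k - p k) with hδ
  have hxV : x ∈ trialSpace w n := Submodule.sum_mem _ fun i hi =>
    Submodule.smul_mem _ _ (hp i (by have := Finset.mem_range.mp hi; omega))
  have hδm : ∀ i ∈ Finset.range (j + 1), b i - p i ∈ (pow A (1 / 2)).domain := fun i hi =>
    Submodule.sub_mem _ (hbD i)
      (h.trialSpace_le (hp i (by have := Finset.mem_range.mp hi; omega)))
  have hδD : δ ∈ (pow A (1 / 2)).domain := Submodule.sum_mem _ fun i hi =>
    Submodule.smul_mem _ _ (hδm i hi)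
  have hxy : x = y - δ := by
    rw [hx, hy, hδ, ← Finset.sum_sub_distrib]
    exact Finset.sum_congr rfl fun i _ => by rw [smul_sub]; abel
  have hby : ∀ i, inner ℂ (b i) y = if i < j + 1 then c i else 0 := by
    intro i
    rw [hy, inner_sum]
    simp only [inner_smul_right, orthonormal_iff_ite.mp b.orthonormal]
    simp
  have hcy : ∀ i ∈ Finset.range (j + 1), ‖c i‖ ≤ ‖y‖ := by
    intro i hi
    have h1 := norm_inner_le_norm (𝕜 := ℂ) (b i) y
    rwa [hby, if_pos (Finset.mem_range.mp hi), b.orthonormal.norm_eq_one, one_mul] at h1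
  have hy0 : 0 < ‖y‖ := (norm_pos_iff.mpr hck₀).trans_le (hcy k₀ (Finset.mem_range.mpr hk₀))
  have hδe : powNorm A (1 / 2) δ ≤ (j + 1) * e * ‖y‖ := by
    refine (powNorm_sum_smul_le _ hδm c).trans ?_
    calc _ ≤ ∑ i ∈ Finset.range (j + 1), ‖y‖ * e := Finset.sum_le_sum fun i hi =>
          mul_le_mul (hcy i hi) (hpe i (by have := Finset.mem_range.mp hi; omega))
            (powNorm_nonneg _ _) hy0.le
      _ = (j + 1) * e * ‖y‖ := by simp; ring
  have hδn : ‖δ‖ ≤ 1 / 2 * ‖y‖ := by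
    refine (he.norm_le_energy hA hpos hδD).trans ?_
    calc _ ≤ r 0 ^ (-(1 / 2) : ℝ) * ((j + 1) * e * ‖y‖) := by gcongr
      _ = ((j + 1) * (r 0 ^ (-(1 / 2) : ℝ) * e)) * ‖y‖ := by ring
      _ ≤ _ := by gcongr
  have hxn : ‖y‖ ≤ 2 * ‖x‖ := by
    have : ‖y‖ - ‖δ‖ ≤ ‖x‖ := by rw [hxy]; exact norm_sub_norm_le _ _
    linarith
  -- `x` is orthogonal to the Ritz vectors before `v j`
  have h1 : L j * ‖x‖ ^ 2 ≤ powNorm A (1 / 2) x ^ 2 := by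
    rw [← h.sum_mul_sq_norm hxV, ← h.sum_sq_norm hxV, Finset.mul_sum]
    refine Finset.sum_le_sum fun i hi => ?_
    rcases lt_or_ge i j with hij | hij
    · rw [hc i hij]; simp
    · have := h.monotone j i hij (Finset.mem_range.mp hi)
      gcongr
  have h2 : powNorm A (1 / 2) x ^ 2 - r j * ‖x‖ ^ 2 ≤ powNorm A (1 / 2) δ ^ 2 := by
    refine hasSum_le (fun k => ?_) ((he.hasSum_energy hA hpos (h.trialSpace_le hxV)).sub
      ((hasSum_sq_norm_inner b x).mul_left (r j))) (he.hasSum_energy hA hpos hδD)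
    have hk := he.pos hpos k
    rw [← sub_mul]
    rcases lt_or_ge k (j + 1) with hkj | hkj
    · have h3 : r k - r j ≤ 0 := sub_nonpos.mpr (he.monotone (by omega))
      exact (mul_nonpos_of_nonpos_of_nonneg h3 (sq_nonneg _)).trans (by positivity)
    · rw [hxy, inner_sub_right, hby, if_neg (not_lt.mpr hkj), zero_sub, norm_neg]
      have := he.pos hpos j
      gcongr
      linarith
  have h3 : powNorm A (1 / 2) δ ^ 2 ≤ 4 * (j + 1) ^ 2 * e ^ 2 * ‖x‖ ^ 2 := by
    calc powNorm A (1 / 2) δ ^ 2 ≤ ((j + 1) * e * (2 * ‖x‖)) ^ 2 := by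
          refine pow_le_pow_left₀ (powNorm_nonneg _ _) (hδe.trans ?_) 2
          gcongr
      _ = _ := by ring
  have hx0 : 0 < ‖x‖ ^ 2 := by
    have : 0 < ‖x‖ := by linarith
    positivity
  refine le_of_mul_le_mul_right ?_ hx0
  linarith

/-- Ritz vectors approximate the eigenspace as well, in the energy norm, as the first `ℓ`
eigenvectors are approximated by trial vectors. Components of `v j` along other eigenvectors
among these are controlled by the Galerkin equation, and those beyond by the identity
`∑ (r k - L j) ‖⟨b k, v j⟩‖² = 0` together with the quadratic estimate of `L j - r j`. -/
theorem IsEigenEnumeration.exists_ritzVector_error (hA : IsSelfAdjoint A)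
    (hpos : IsPositiveDefinite A) (he : IsEigenEnumeration A r b) {ℓ j : ℕ} (hjℓ : r j < r ℓ) :
    ∃ C ≥ 0, ∃ ε > 0, ∀ (w : ℕ → H) (n : ℕ) (L : ℕ → ℝ) (v : ℕ → H), IsRayleighRitz A w n L v →
      j < n → ∀ (p : ℕ → H) (e : ℝ), (∀ k < ℓ, p k ∈ trialSpace w n) →
      (∀ k < ℓ, powNorm A (1 / 2) (b k - p k) ≤ e) → e ≤ ε →
      powNorm A (1 / 2) (v j - eigenComponent b r ℓ j (v j)) ≤ C * e := by
  obtain ⟨g, hg, hgℓ, hgk⟩ := exists_gap hjℓ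
  have hjlt : j < ℓ := he.monotone.reflect_lt hjℓ
  have hrj := he.pos hpos j
  have hrℓ := he.pos hpos ℓ
  have hκ : 0 < r 0 ^ (-(1 / 2) : ℝ) := Real.rpow_pos_of_pos (he.pos hpos 0) _
  set κ := r 0 ^ (-(1 / 2) : ℝ) with hκdef
  -- `S` bounds the Ritz value, `K` is the constant in the estimate of the components along the
  -- other eigenvectors below the gap, and `c` satisfies `r k ≤ c * (r k - L j)` above the gap.
  set S := r j + g with hS
  set K := (√S + S * κ) / g with hK
  set c := (r j + 2 * g) / g with hc
  have hcg : c * g = r j + 2 * g := div_mul_cancel₀ _ hg.ne'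
  have hc0 : 0 < c := by positivity
  have hS0 : 0 < S := by positivity
  set D := c * (4 * (j + 1) ^ 2) + (r ℓ + c * S) * K ^ 2 with hD
  have hD1 : 0 ≤ c * (4 * ((j : ℝ) + 1) ^ 2) := by positivity
  have hD2 : 0 ≤ (r ℓ + c * S) * K ^ 2 := by positivity
  have hD0 : 0 ≤ D := add_nonneg hD1 hD2
  refine ⟨√(ℓ * D), Real.sqrt_nonneg _, min (1 / (2 * (j + 1) * κ)) (√g / (2 * (j + 1))),
    by positivity, ?_⟩
  intro w n L v h hjn p e hp hpe heε
  have he0 : 0 ≤ e := (powNorm_nonneg _ _).trans (hpe j hjlt)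
  -- The first entry of the minimum is what the estimate of the Ritz value needs, the second makes
  -- that estimate keep the Ritz value within `g` of the eigenvalue.
  have hsmall : (j + 1) * (κ * e) ≤ 1 / 2 := by
    have h1 := heε.trans (min_le_left _ _)
    rw [le_div_iff₀ (by positivity)] at h1
    linarith
  have hsmall2 : 4 * ((j : ℝ) + 1) ^ 2 * e ^ 2 ≤ g := by
    have h1 := heε.trans (min_le_right _ _)
    rw [le_div_iff₀ (by positivity)] at h1
    have h2 := pow_le_pow_left₀ (by positivity) h1 2
    rw [Real.sq_sqrt hg.le] at h2
    linarith
  have hLlo := h.eigenvalue_le hA hpos he hjn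
  have hLup := h.ritzValue_le hA hpos he (fun k hk => hp k (by omega))
    (fun k hk => hpe k (by omega)) hsmall
  have hLS : L j ≤ S := by linarith
  have hL0 : 0 < L j := hrj.trans_le hLlo
  have hvD := h.mem_domain hjn
  have hvn : ‖v j‖ = 1 := h.orthonormal.norm_eq_one ⟨j, hjn⟩
  have hven : powNorm A (1 / 2) (v j) ^ 2 = L j := by
    rw [← h.sum_mul_sq_norm (h.mem_trialSpace hjn), Finset.sum_congr rfl fun i hi => by
      rw [h.inner_eq_ite (Finset.mem_range.mp hi) hjn]]
    rw [Finset.sum_eq_single j]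
    · simp
    · intro i _ hij; simp [hij]
    · intro hj; exact absurd (Finset.mem_range.mpr hjn) hj
  have hvle : ∀ k, ‖inner ℂ (b k) (v j)‖ ≤ 1 := fun k => by
    have h1 := norm_inner_le_norm (𝕜 := ℂ) (b k) (v j)
    rwa [hvn, b.orthonormal.norm_eq_one, one_mul] at h1
  -- components along the eigenvectors of the other eigenvalues below the gap
  have hcomp : ∀ k < ℓ, r k ≠ r j → ‖inner ℂ (b k) (v j)‖ ≤ K * e := by
    intro k hk hkj
    have hbD := he.basis_mem_pow_domain hA hpos (s := 1 / 2) (by norm_num) k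
    have hpD := h.trialSpace_le (hp k hk)
    have h1 : ((r k - L j : ℝ) : ℂ) * inner ℂ (b k) (v j)
        = inner ℂ (powApply A (1 / 2) (b k - p k)) (powApply A (1 / 2) (v j))
          - (L j : ℂ) * inner ℂ (b k - p k) (v j) := by
      rw [powApply_sub hbD hpD, inner_sub_left, inner_sub_left,
        he.inner_powApply_basis hA hpos hvD, h.inner_powApply hjn (hp k hk)]
      push_cast
      ring
    have h2 : g ≤ |r k - L j| := by
      have h3 := hgk k hk hkj
      have h4 := abs_sub_le (r k) (L j) (r j)
      rw [abs_of_nonneg (sub_nonneg.mpr hLlo)] at h4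
      linarith
    have h3 : powNorm A (1 / 2) (v j) ≤ √S := Real.le_sqrt_of_sq_le (hven.le.trans hLS)
    have h4 := congrArg norm h1
    rw [norm_mul, Complex.norm_real, Real.norm_eq_abs] at h4
    have h5 : ‖inner ℂ (b k - p k) (v j)‖ ≤ κ * e := by
      refine (norm_inner_le_norm _ _).trans ?_
      rw [hvn, mul_one]
      refine (he.norm_le_energy hA hpos (Submodule.sub_mem _ hbD hpD)).trans ?_
      exact mul_le_mul_of_nonneg_left (hpe k hk) hκ.le
    have h6 : ‖inner ℂ (powApply A (1 / 2) (b k - p k)) (powApply A (1 / 2) (v j))‖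
        ≤ e * √S := by
      refine (norm_inner_le_norm _ _).trans ?_
      exact mul_le_mul (hpe k hk) h3 (norm_nonneg _) he0
    have h7 : g * ‖inner ℂ (b k) (v j)‖ ≤ e * √S + S * (κ * e) := by
      calc g * ‖inner ℂ (b k) (v j)‖ ≤ |r k - L j| * ‖inner ℂ (b k) (v j)‖ := by gcongr
        _ ≤ _ := h4.le
        _ ≤ _ := norm_sub_le _ _
        _ ≤ _ := by
          rw [norm_mul, Complex.norm_real, Real.norm_of_nonneg hL0.le]
          gcongr
    rw [hK, div_mul_eq_mul_div, le_div_iff₀ hg]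
    linarith
  have hzD : v j - eigenComponent b r ℓ j (v j) ∈ (pow A (1 / 2)).domain :=
    Submodule.sub_mem _ hvD (Submodule.sum_mem _ fun k _ => Submodule.smul_mem _ _
      (he.basis_mem_pow_domain hA hpos (by norm_num) k))
  have hzero := ((he.hasSum_energy hA hpos hvD).sub
    ((hasSum_sq_norm_inner b (v j)).mul_left (L j))).mul_left c
  rw [hven, hvn, one_pow, mul_one, sub_self, mul_zero] at hzero
  have hd : HasSum (fun k => if k ∈ Finset.range ℓ then D * e ^ 2 else 0)
      (∑ k ∈ Finset.range ℓ, if k ∈ Finset.range ℓ then D * e ^ 2 else 0) :=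
    hasSum_sum_of_ne_finset_zero fun k hk => if_neg hk
  -- Termwise comparison with `c * (r k - L j) * ‖⟨b k, v j⟩‖ ^ 2`, which sums to zero, plus a
  -- correction `D * e ^ 2` for each of the finitely many indices below the gap.
  have hle := hasSum_le (fun k => ?_) (he.hasSum_energy hA hpos hzD) (hzero.add hd)
  · rw [zero_add, Finset.sum_congr rfl fun k hk => if_pos hk, Finset.sum_const,
      Finset.card_range, nsmul_eq_mul] at hle
    refine le_of_sq_le_sq (hle.trans ?_) (by positivity)
    rw [mul_pow, Real.sq_sqrt (by positivity)]
    linarith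
  · have hk0 := he.pos hpos k
    set t := ‖inner ℂ (b k) (v j)‖ with ht
    have ht0 : 0 ≤ t := norm_nonneg _
    rw [inner_sub_right, inner_eigenComponent]
    by_cases hkℓ : k < ℓ
    · rw [if_pos (Finset.mem_range.mpr hkℓ)]
      by_cases hkj : r k = r j
      · rw [if_pos ⟨hkℓ, hkj⟩, sub_self, norm_zero, hkj]
        have h1 : t ^ 2 ≤ 1 := by
          have := pow_le_pow_left₀ ht0 (hvle k) 2
          simpa using this
        have h2 : c * ((L j - r j) * t ^ 2) ≤ c * (4 * (j + 1) ^ 2) * e ^ 2 := by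
          have h3 : (L j - r j) * t ^ 2 ≤ (4 * (j + 1) ^ 2 * e ^ 2) * 1 :=
            mul_le_mul (by linarith) h1 (sq_nonneg _) (by positivity)
          have h4 := mul_le_mul_of_nonneg_left h3 hc0.le
          linarith
        have h3 : 0 ≤ (r ℓ + c * S) * K ^ 2 * e ^ 2 := mul_nonneg hD2 (sq_nonneg _)
        have h4 : D * e ^ 2 = c * (4 * (j + 1) ^ 2) * e ^ 2 + (r ℓ + c * S) * K ^ 2 * e ^ 2 := by
          rw [hD]; ring
        rw [h4]
        nlinarith
      · rw [if_neg (fun h => hkj h.2), sub_zero]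
        have h1 : t ^ 2 ≤ (K * e) ^ 2 := pow_le_pow_left₀ ht0 (hcomp k hkℓ hkj) 2
        have h2 : (r ℓ + c * S) * t ^ 2 ≤ (r ℓ + c * S) * (K * e) ^ 2 := by gcongr
        have h3 : 0 ≤ c * (4 * ((j : ℝ) + 1) ^ 2) * e ^ 2 := mul_nonneg hD1 (sq_nonneg _)
        have h4 : D * e ^ 2 = c * (4 * (j + 1) ^ 2) * e ^ 2 + (r ℓ + c * S) * (K * e) ^ 2 := by
          rw [hD]; ring
        have h5 : r k * t ^ 2 ≤ r ℓ * t ^ 2 := by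
          have := he.monotone hkℓ.le
          gcongr
        have h6 : c * L j * t ^ 2 ≤ c * S * t ^ 2 := by gcongr
        have h7 : 0 ≤ c * r k * t ^ 2 := by positivity
        rw [h4]
        linarith
    · have hkn : k ∉ Finset.range ℓ := fun h => hkℓ (Finset.mem_range.mp h)
      rw [if_neg hkn, if_neg (fun h => hkℓ h.1), sub_zero, add_zero, ← sub_mul, ← mul_assoc]
      have h1 : r ℓ ≤ r k := he.monotone (not_lt.mp hkℓ)
      have h2 : r k ≤ c * (r k - L j) := by
        have h3 : c * (r k - S) ≤ c * (r k - L j) := by gcongr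
        have h4 : 1 ≤ c := by rw [hc, le_div_iff₀ hg]; linarith
        have h5 : 0 ≤ (c - 1) * (r k - r j - 2 * g) :=
          mul_nonneg (by linarith) (by linarith)
        rw [hS] at h3
        linarith
      gcongr

end Ritz

/-! ### Spectral cut-off and the inverse estimate for trial vectors -/

section CutOff

variable {H : Type*} [NormedAddCommGroup H] [InnerProductSpace ℂ H]
  {G : Type*} [NormedAddCommGroup G] [InnerProductSpace ℂ G]

open Classical in
theorem exists_inner_eq_ite (b : HilbertBasis ℕ ℂ H) (P : ℕ → Prop) (x : H) :
    ∃ y, ∀ k, inner ℂ (b k) y = if P k then inner ℂ (b k) x else 0 := by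
  refine exists_forall_inner_eq b ((hasSum_sq_norm_inner b x).summable.of_nonneg_of_le
    (fun k => sq_nonneg _) fun k => ?_)
  split_ifs
  · exact le_rfl
  · simp only [norm_zero, ne_eq, OfNat.ofNat_ne_zero, not_false_eq_true, zero_pow]
    positivity

theorem truncation_of_mem_trialSpace {q : HilbertBasis ℕ ℂ G} {ι : H ≃L[ℂ] G} {n : ℕ}
    {x : H} (hx : x ∈ trialSpace (fun k => ι.symm (q k)) n) : truncation q n (ι x) = ι x := by
  refine truncation_eq_self q ?_
  have h1 : ι x ∈ (trialSpace (fun k => ι.symm (q k)) n).map (ι.toLinearEquiv : H →ₗ[ℂ] G) :=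
    Submodule.mem_map_of_mem hx
  rw [trialSpace, Submodule.map_span, ← Set.image_comp] at h1
  have h2 : (ι.toLinearEquiv : H →ₗ[ℂ] G) ∘ (fun k => ι.symm (q k)) = q :=
    funext fun k => ι.apply_symm_apply _
  rwa [h2] at h1

theorem symm_truncation_mem_trialSpace {q : HilbertBasis ℕ ℂ G} {ι : H ≃L[ℂ] G} (n : ℕ)
    (y : G) :
    ι.symm (truncation q n y) ∈ trialSpace (fun k => ι.symm (q k)) n := by
  rw [truncation, map_sum]
  refine Submodule.sum_mem _ fun k hk => ?_
  rw [map_smul]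
  exact Submodule.smul_mem _ _ (Submodule.subset_span ⟨k, Finset.mem_range.mp hk, rfl⟩)

end CutOff

section Estimates

variable {H : Type*} [NormedAddCommGroup H] [InnerProductSpace ℂ H] [CompleteSpace H]
  {A : H →ₗ.[ℂ] H} {r : ℕ → ℝ} {b : HilbertBasis ℕ ℂ H}

/-- Cut-off at the spectral level `m`: the low part of `x` gains smoothness at the cost of powers
of `m`, the high part is small. -/
theorem IsEigenEnumeration.exists_cutoff (hA : IsSelfAdjoint A) (hpos : IsPositiveDefinite A)
    (he : IsEigenEnumeration A r b) {m : ℝ} (hm : 0 < m) (x : H) :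
    ∃ y : H,
      (∀ s t : ℝ, 0 ≤ s → s ≤ t → x ∈ (pow A s).domain →
        y ∈ (pow A t).domain ∧ powNorm A t y ≤ m ^ (t - s) * powNorm A s x) ∧
      (∀ s t : ℝ, 0 ≤ s → s ≤ t → x ∈ (pow A t).domain →
        powNorm A s (x - y) ≤ m ^ (s - t) * powNorm A t x) := by
  classical
  obtain ⟨y, hy⟩ := exists_inner_eq_ite b (fun k => r k ≤ m) x
  refine ⟨y, fun s t hs hst hx => ?_, fun s t hs hst hx => ?_⟩
  · refine he.powNorm_le hA hpos (hs.trans hst) hs hx (Real.rpow_nonneg hm.le _) fun k => ?_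
    have hk := he.pos hpos k
    have h0 := Real.rpow_nonneg hk.le s
    have h1 := Real.rpow_nonneg hm.le (t - s)
    rw [hy]
    split_ifs with hkm
    · have h2 : r k ^ t = r k ^ (t - s) * r k ^ s := by rw [← Real.rpow_add hk]; simp
      have h3 := Real.rpow_le_rpow hk.le hkm (sub_nonneg.mpr hst)
      rw [h2, mul_assoc]
      gcongr
    · simp only [norm_zero, mul_zero]
      positivity
  · refine (he.powNorm_le hA hpos hs (hs.trans hst) hx (Real.rpow_nonneg hm.le _) fun k => ?_).2
    have hk := he.pos hpos k
    have h0 := Real.rpow_nonneg hk.le t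
    have h1 := Real.rpow_nonneg hm.le (s - t)
    rw [inner_sub_right, hy]
    split_ifs with hkm
    · simp only [sub_self, norm_zero, mul_zero]
      positivity
    · have h2 : r k ^ s = r k ^ (s - t) * r k ^ t := by rw [← Real.rpow_add hk]; simp
      have h3 := Real.rpow_le_rpow_of_nonpos hm (not_le.mp hkm).le (sub_nonpos.mpr hst)
      rw [sub_zero, h2, mul_assoc]
      gcongr

/-- Interpolation between the norm of `H` and a stronger power norm. -/
theorem IsEigenEnumeration.energy_le_add (hA : IsSelfAdjoint A) (hpos : IsPositiveDefinite A)
    (he : IsEigenEnumeration A r b) {τ : ℝ} (hτ : 1 / 2 ≤ τ) {m : ℝ} (hm : 0 < m) {x : H}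
    (hx : x ∈ (pow A τ).domain) (hx' : x ∈ (pow A (1 / 2)).domain) :
    powNorm A (1 / 2) x ≤ m ^ (1 / 2 : ℝ) * ‖x‖ + m ^ (1 / 2 - τ) * powNorm A τ x := by
  obtain ⟨y, hlow, hhigh⟩ := he.exists_cutoff hA hpos hm x
  obtain ⟨hyD, hy⟩ := hlow 0 (1 / 2) le_rfl (by norm_num) (mem_pow_domain_zero hA hpos x)
  rw [powNorm_zero hA hpos, sub_zero] at hy
  have h1 := hhigh (1 / 2) τ (by norm_num) hτ hx
  have h2 := powNorm_add_le hyD (Submodule.sub_mem _ hx' hyD)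
  rw [add_sub_cancel] at h2
  linarith

theorem IsEigenEnumeration.mem_pow_domain_mono (hA : IsSelfAdjoint A)
    (hpos : IsPositiveDefinite A) (he : IsEigenEnumeration A r b) {s t : ℝ} (hs : 0 ≤ s)
    (hst : s ≤ t) {x : H} (hx : x ∈ (pow A t).domain) : x ∈ (pow A s).domain := by
  refine (he.powNorm_le hA hpos hs (hs.trans hst) hx
    (Real.rpow_nonneg (he.pos hpos 0).le (s - t)) fun k => ?_).1
  have hk := he.pos hpos k
  have h2 : r k ^ s = r k ^ (s - t) * r k ^ t := by rw [← Real.rpow_add hk]; simp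
  have h3 := Real.rpow_le_rpow_of_nonpos (he.pos hpos 0) (he.monotone (Nat.zero_le k))
    (sub_nonpos.mpr hst)
  have h0 := Real.rpow_nonneg hk.le t
  rw [h2, mul_assoc]
  gcongr

variable {G : Type*} [NormedAddCommGroup G] [InnerProductSpace ℂ G] [CompleteSpace G]
  {M : G →ₗ.[ℂ] G} {μ : ℕ → ℝ} {q : HilbertBasis ℕ ℂ G} {ι : H ≃L[ℂ] G} {τ : ℝ}

theorem SameDomain.trialSpace_le (hM : IsSelfAdjoint M) (hMpos : IsPositiveDefinite M)
    (hq : IsEigenEnumeration M μ q) (hτ : 0 ≤ τ) (hdom : SameDomain ι A M τ) (n : ℕ) :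
    trialSpace (fun k => ι.symm (q k)) n ≤ (pow A τ).domain := by
  intro x hx
  rw [hdom.1, ← truncation_of_mem_trialSpace hx]
  exact hq.truncation_mem_pow_domain hM hMpos hτ n _

/-- The inverse estimate between the energy norm and the stronger norm for trial vectors. The
inverse estimate for `M` only compares with the norm of `G`, so it is applied to the high part of
the trial vector with respect to the spectrum of `A`; the low part satisfies the desired estimate
already because of the spectral cut-off. -/
theorem SameDomain.exists_inverse_estimate (hA : IsSelfAdjoint A) (hpos : IsPositiveDefinite A)
    (he : IsEigenEnumeration A r b) (hM : IsSelfAdjoint M) (hMpos : IsPositiveDefinite M)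
    (hq : IsEigenEnumeration M μ q) (hτ : 1 / 2 ≤ τ) (hdom : SameDomain ι A M τ) :
    ∃ K ≥ 0, ∀ n, ∀ x ∈ trialSpace (fun k => ι.symm (q k)) n,
      powNorm A τ x ≤ K * (μ n ^ (τ - 1 / 2) * powNorm A (1 / 2) x) := by
  have hτ0 : 0 ≤ τ := by linarith
  have hdom' := hdom
  obtain ⟨hiff, c, C, hc, hC, hle⟩ := hdom
  refine ⟨C * (‖(ι : H →L[ℂ] G)‖ + c⁻¹), by positivity, fun n x hx => ?_⟩
  have hm := hMpos |> hq.pos (k := n)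
  have hxτ := hdom'.trialSpace_le hM hMpos hq hτ0 n hx
  have hxD := he.mem_pow_domain_mono hA hpos (by norm_num) hτ hxτ
  obtain ⟨y, hlow, hhigh⟩ := he.exists_cutoff hA hpos hm x
  obtain ⟨hyD, hy⟩ := hlow (1 / 2) τ (by norm_num) hτ hxD
  have hxy := hhigh 0 (1 / 2) le_rfl (by norm_num) hxD
  rw [powNorm_zero hA hpos, zero_sub] at hxy
  set E := powNorm A (1 / 2) x
  have hyM := (hiff y).mp hyD
  have h1 : powNorm M τ (ι x) ≤ μ n ^ τ * ‖ι (x - y)‖ + powNorm M τ (ι y) := by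
    have h2 : ι x = truncation q n (ι (x - y)) + truncation q n (ι y) := by
      rw [← truncation_add, ← map_add, sub_add_cancel, truncation_of_mem_trialSpace hx]
    rw [h2]
    refine (powNorm_add_le (hq.truncation_mem_pow_domain hM hMpos hτ0 n _)
      (hq.truncation_mem_pow_domain hM hMpos hτ0 n _)).trans (add_le_add ?_ ?_)
    · exact hq.powNorm_truncation_le hM hMpos hτ0 n _
    · exact hq.powNorm_truncation_le_powNorm hM hMpos hτ0 n hyM
  have h2 : powNorm M τ (ι y) ≤ c⁻¹ * (μ n ^ (τ - 1 / 2) * E) := by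
    have := (hle y hyD).1
    rw [inv_mul_eq_div, le_div_iff₀ hc]
    linarith
  have h3 : μ n ^ τ * ‖ι (x - y)‖ ≤ ‖(ι : H →L[ℂ] G)‖ * (μ n ^ (τ - 1 / 2) * E) := by
    have h4 : ‖ι (x - y)‖ ≤ ‖(ι : H →L[ℂ] G)‖ * ‖x - y‖ := (ι : H →L[ℂ] G).le_opNorm _
    have h5 : μ n ^ (τ - 1 / 2) = μ n ^ τ * μ n ^ (-(1 / 2) : ℝ) := by
      rw [← Real.rpow_add hm]; ring_nf
    have h6 := Real.rpow_nonneg hm.le τ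
    calc μ n ^ τ * ‖ι (x - y)‖
        ≤ μ n ^ τ * (‖(ι : H →L[ℂ] G)‖ * (μ n ^ (-(1 / 2) : ℝ) * E)) := by
          gcongr
          exact h4.trans (by gcongr)
      _ = _ := by rw [h5]; ring
  calc powNorm A τ x ≤ C * powNorm M τ (ι x) := (hle x hxτ).2
    _ ≤ C * (‖(ι : H →L[ℂ] G)‖ * (μ n ^ (τ - 1 / 2) * E) + c⁻¹ * (μ n ^ (τ - 1 / 2) * E)) := by
        gcongr
        linarith
    _ = _ := by ring

/-- Cutting off the expansion in the trial vectors gives a good approximation in the stronger norm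
and, with a gain, in the energy norm. -/
theorem SameDomain.exists_direct_estimate (hA : IsSelfAdjoint A) (hpos : IsPositiveDefinite A)
    (he : IsEigenEnumeration A r b) (hM : IsSelfAdjoint M) (hMpos : IsPositiveDefinite M)
    (hq : IsEigenEnumeration M μ q) (hτ : 1 / 2 ≤ τ) (hdom : SameDomain ι A M τ) :
    ∃ K ≥ 0, ∀ n, ∀ x ∈ (pow A τ).domain,
      powNorm A τ (x - ι.symm (truncation q n (ι x)))
        ≤ K * powNorm M τ (ι x - truncation q n (ι x)) ∧
      powNorm A (1 / 2) (x - ι.symm (truncation q n (ι x)))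
        ≤ K * (μ n ^ (1 / 2 - τ) * powNorm M τ (ι x - truncation q n (ι x))) := by
  have hτ0 : 0 ≤ τ := by linarith
  have hdom' := hdom
  obtain ⟨hiff, c, C, hc, hC, hle⟩ := hdom
  refine ⟨‖(ι.symm : G →L[ℂ] H)‖ + C, by positivity, fun n x hx => ?_⟩
  have hm := hMpos |> hq.pos (k := n)
  have hzD : x - ι.symm (truncation q n (ι x)) ∈ (pow A τ).domain := Submodule.sub_mem _ hx
    (hdom'.trialSpace_le hM hMpos hq hτ0 n (symm_truncation_mem_trialSpace n _))
  set z := x - ι.symm (truncation q n (ι x)) with hz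
  have hιz : ι z = ι x - truncation q n (ι x) := by rw [hz, map_sub]; simp
  rw [← hιz]
  set N := powNorm M τ (ι z) with hN
  have hN0 : 0 ≤ N := powNorm_nonneg _ _
  have h1 : powNorm A τ z ≤ C * N := (hle z hzD).2
  have h2 : ‖z‖ ≤ ‖(ι.symm : G →L[ℂ] H)‖ * (μ n ^ (-τ) * N) := by
    have h3 := (ι.symm : G →L[ℂ] H).le_opNorm (ι z)
    have h4 := hq.powNorm_sub_truncation_le hM hMpos le_rfl hτ0 n ((hiff x).mp hx)
    rw [powNorm_zero hM hMpos, ← hιz, zero_sub] at h4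
    have h5 : (ι.symm : G →L[ℂ] H) (ι z) = z := by simp
    rw [h5] at h3
    exact h3.trans (by gcongr)
  refine ⟨h1.trans ?_, ?_⟩
  · have := norm_nonneg (ι.symm : G →L[ℂ] H)
    gcongr
    linarith
  · refine (he.energy_le_add hA hpos hτ hm hzD
      (he.mem_pow_domain_mono hA hpos (by norm_num) hτ hzD)).trans ?_
    have h5 : μ n ^ (1 / 2 - τ) = μ n ^ (1 / 2 : ℝ) * μ n ^ (-τ) := by
      rw [← Real.rpow_add hm]; ring_nf
    have h6 := Real.rpow_nonneg hm.le (1 / 2)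
    have h7 := Real.rpow_nonneg hm.le (1 / 2 - τ)
    calc _ ≤ μ n ^ (1 / 2 : ℝ) * (‖(ι.symm : G →L[ℂ] H)‖ * (μ n ^ (-τ) * N))
          + μ n ^ (1 / 2 - τ) * (C * N) := by gcongr
      _ = _ := by rw [h5]; ring

end Estimates

/-! ### Convergence of the Ritz vectors -/

section NormalizedComponent

variable {H : Type*} [NormedAddCommGroup H] [InnerProductSpace ℂ H] {r : ℕ → ℝ}
  {b : HilbertBasis ℕ ℂ H}

open Classical in
/-- The normalized component of `x` in the eigenspace of `b j`, replaced by `b j` if it vanishes. -/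
noncomputable def normalizedComponent (b : HilbertBasis ℕ ℂ H) (r : ℕ → ℝ) (ℓ j : ℕ) (x : H) : H :=
  if eigenComponent b r ℓ j x = 0 then b j
  else ((‖eigenComponent b r ℓ j x‖⁻¹ : ℝ) : ℂ) • eigenComponent b r ℓ j x

theorem norm_normalizedComponent (ℓ j : ℕ) (x : H) : ‖normalizedComponent b r ℓ j x‖ = 1 := by
  rw [normalizedComponent]
  split_ifs with h
  · exact b.orthonormal.norm_eq_one j
  · rw [norm_smul, Complex.norm_real, norm_inv, norm_norm, inv_mul_cancel₀ (norm_ne_zero_iff.mpr h)]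

theorem truncation_normalizedComponent {ℓ j : ℕ} (hj : j < ℓ) (x : H) :
    truncation b ℓ (normalizedComponent b r ℓ j x) = normalizedComponent b r ℓ j x := by
  refine truncation_eq_self b ?_
  have hmem : ∀ k < ℓ, b k ∈ Submodule.span ℂ (b '' {k | k < ℓ}) := fun k hk =>
    Submodule.subset_span ⟨k, hk, rfl⟩
  rw [normalizedComponent]
  split_ifs with h
  · exact hmem j hj
  · exact Submodule.smul_mem _ _ (Submodule.sum_mem _ fun k hk => Submodule.smul_mem _ _
      (hmem k (Finset.mem_range.mp (Finset.mem_filter.mp hk).1)))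

/-- For a simple eigenvalue and a correctly oriented vector, the normalized component in the
eigenspace is the given eigenvector. -/
theorem normalizedComponent_eq_of_simple {ℓ j : ℕ} (hj : j < ℓ) (hsimple : ∀ k, r k = r j → k = j)
    {x : H} (hre : 0 ≤ (inner ℂ (b j) x).re) (him : (inner ℂ (b j) x).im = 0) :
    normalizedComponent b r ℓ j x = b j := by
  have hfil : (Finset.range ℓ).filter (fun k => r k = r j) = {j} := by
    ext k
    simp only [Finset.mem_filter, Finset.mem_range, Finset.mem_singleton]
    exact ⟨fun h => hsimple k h.2, fun h => by subst h; exact ⟨hj, rfl⟩⟩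
  have hz : eigenComponent b r ℓ j x = (((inner ℂ (b j) x).re : ℝ) : ℂ) • b j := by
    rw [eigenComponent, hfil, Finset.sum_singleton]
    congr 1
    exact Complex.ext (by simp) (by simp [him])
  rw [normalizedComponent]
  split_ifs with h
  · rfl
  · rw [hz] at h ⊢
    have hne : (inner ℂ (b j) x).re ≠ 0 := fun h0 => h (by rw [h0]; simp)
    rw [norm_smul, b.orthonormal.norm_eq_one, mul_one, Complex.norm_real,
      Real.norm_of_nonneg hre, smul_smul, ← Complex.ofReal_mul, inv_mul_cancel₀ hne]
    simp

end NormalizedComponent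

section Convergence

variable {H : Type*} [NormedAddCommGroup H] [InnerProductSpace ℂ H] [CompleteSpace H]
  {A : H →ₗ.[ℂ] H} {r : ℕ → ℝ} {b : HilbertBasis ℕ ℂ H}

theorem IsEigenEnumeration.inEigenspace_normalizedComponent (hA : IsSelfAdjoint A)
    (hpos : IsPositiveDefinite A) (he : IsEigenEnumeration A r b) (ℓ j : ℕ) (x : H) :
    InEigenspace A (r j) (normalizedComponent b r ℓ j x) := by
  rw [normalizedComponent]
  split_ifs with h
  · exact he.eigen j
  · rw [← inv_inv (r j)]
    refine inEigenspace_of_inverse_apply hA hpos (inv_ne_zero (he.pos hpos j).ne') ?_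
    rw [map_smul, smul_comm]
    congr 1
    rw [eigenComponent, map_sum, Finset.smul_sum]
    refine Finset.sum_congr rfl fun k hk => ?_
    rw [map_smul, (he.eigen k).inverse_apply hA hpos (he.pos hpos k).ne',
      (Finset.mem_filter.mp hk).2, smul_comm]

/-- Replacing the component in the eigenspace by its normalization does not spoil a small energy
error. -/
theorem IsEigenEnumeration.energy_normalizedComponent_sub_le (hA : IsSelfAdjoint A)
    (hpos : IsPositiveDefinite A) (he : IsEigenEnumeration A r b) {ℓ j : ℕ} {x : H}
    (hx : x ∈ (pow A (1 / 2)).domain) (hx1 : ‖x‖ = 1) {d : ℝ}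
    (hd : powNorm A (1 / 2) (x - eigenComponent b r ℓ j x) ≤ d)
    (hsmall : r 0 ^ (-(1 / 2) : ℝ) * d < 1) :
    powNorm A (1 / 2) (normalizedComponent b r ℓ j x - x)
      ≤ (1 + r j ^ (1 / 2 : ℝ) * r 0 ^ (-(1 / 2) : ℝ)) * d := by
  have hrj := Real.rpow_nonneg (he.pos hpos j).le (1 / 2)
  have hκ := Real.rpow_nonneg (he.pos hpos 0).le (-(1 / 2) : ℝ)
  have hzD : eigenComponent b r ℓ j x ∈ (pow A (1 / 2)).domain :=
    Submodule.sum_mem _ fun k _ => Submodule.smul_mem _ _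
      (he.basis_mem_pow_domain hA hpos (by norm_num) k)
  have hz : powNorm A (1 / 2) (eigenComponent b r ℓ j x)
      ≤ r j ^ (1 / 2 : ℝ) * ‖eigenComponent b r ℓ j x‖ := by
    refine (he.powNorm_le_norm hA hpos (by norm_num) hrj fun k => ?_).2
    rw [inner_eigenComponent]
    split_ifs with hk
    · rw [hk.2]
    · simp
  rw [normalizedComponent]
  set z := eigenComponent b r ℓ j x
  have hdist : ‖x - z‖ ≤ r 0 ^ (-(1 / 2) : ℝ) * d :=
    (he.norm_le_energy hA hpos (Submodule.sub_mem _ hx hzD)).trans (by gcongr)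
  have hz0 : z ≠ 0 := by
    intro h0
    rw [h0, sub_zero, hx1] at hdist
    linarith
  rw [if_neg hz0]
  have hzn : 0 < ‖z‖ := norm_pos_iff.mpr hz0
  have hsplit : ((‖z‖⁻¹ : ℝ) : ℂ) • z - x = ((‖z‖⁻¹ - 1 : ℝ) : ℂ) • z - (x - z) := by
    push_cast
    rw [sub_smul, one_smul]
    abel
  have habs : |1 - ‖z‖| ≤ r 0 ^ (-(1 / 2) : ℝ) * d := by
    have h2 := abs_norm_sub_norm_le x z
    rw [hx1] at h2
    exact h2.trans hdist
  have h1 : powNorm A (1 / 2) (((‖z‖⁻¹ - 1 : ℝ) : ℂ) • z)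
      ≤ r j ^ (1 / 2 : ℝ) * (r 0 ^ (-(1 / 2) : ℝ) * d) := by
    rw [powNorm_smul hzD, Complex.norm_real, Real.norm_eq_abs]
    calc |‖z‖⁻¹ - 1| * powNorm A (1 / 2) z ≤ |‖z‖⁻¹ - 1| * (r j ^ (1 / 2 : ℝ) * ‖z‖) := by gcongr
      _ = r j ^ (1 / 2 : ℝ) * |1 - ‖z‖| := by
        have h2 : 1 - ‖z‖ = (‖z‖⁻¹ - 1) * ‖z‖ := by
          rw [sub_mul, inv_mul_cancel₀ hzn.ne', one_mul]
        rw [h2, abs_mul, abs_norm]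
        ring
      _ ≤ _ := by gcongr
  rw [hsplit]
  refine (powNorm_sub_le (Submodule.smul_mem _ _ hzD) (Submodule.sub_mem _ hx hzD)).trans ?_
  linarith

variable {G : Type*} [NormedAddCommGroup G] [InnerProductSpace ℂ G] [CompleteSpace G]
  {M : G →ₗ.[ℂ] G} {μ : ℕ → ℝ} {q : HilbertBasis ℕ ℂ G} {ι : H ≃L[ℂ] G} {τ : ℝ}

/-- The error of the Ritz vectors in the stronger norm is bounded by the error of cutting off the
expansions of the first `ℓ` eigenvectors in the trial vectors. -/
theorem SameDomain.exists_ritz_error_bound (hA : IsSelfAdjoint A) (hpos : IsPositiveDefinite A)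
    (he : IsEigenEnumeration A r b) (hM : IsSelfAdjoint M) (hMpos : IsPositiveDefinite M)
    (hq : IsEigenEnumeration M μ q) (hτ : 1 / 2 ≤ τ) (hdom : SameDomain ι A M τ)
    {L : ℕ → ℕ → ℝ} {v : ℕ → ℕ → H}
    (hv : ∀ n, IsRayleighRitz A (fun k => ι.symm (q k)) n (L n) (v n)) {ℓ j : ℕ}
    (hjℓ : r j < r ℓ) :
    ∃ K : ℝ, ∀ᶠ n in atTop, powNorm A τ (normalizedComponent b r ℓ j (v n j) - v n j)
      ≤ K * ∑ k ∈ Finset.range ℓ, powNorm M τ (ι (b k) - truncation q n (ι (b k))) := by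
  have hτ0 : 0 ≤ τ := by linarith
  have hjlt : j < ℓ := he.monotone.reflect_lt hjℓ
  obtain ⟨Ki, hKi, hinv⟩ := hdom.exists_inverse_estimate hA hpos he hM hMpos hq hτ
  obtain ⟨Kd, hKd, hdir⟩ := hdom.exists_direct_estimate hA hpos he hM hMpos hq hτ
  obtain ⟨C, hC, ε, hε, hritz⟩ := he.exists_ritzVector_error hA hpos hjℓ
  set η : ℕ → ℝ := fun n =>
    ∑ k ∈ Finset.range ℓ, powNorm M τ (ι (b k) - truncation q n (ι (b k))) with hη
  have hbD : ∀ k, b k ∈ (pow A τ).domain := he.basis_mem_pow_domain hA hpos hτ0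
  have hη0 : ∀ n, 0 ≤ η n := fun n => Finset.sum_nonneg fun k _ => powNorm_nonneg _ _
  have hηk : ∀ n, ∀ k < ℓ, powNorm M τ (ι (b k) - truncation q n (ι (b k))) ≤ η n :=
    fun n k hk => Finset.single_le_sum (f := fun k =>
      powNorm M τ (ι (b k) - truncation q n (ι (b k)))) (fun k _ => powNorm_nonneg _ _)
      (Finset.mem_range.mpr hk)
  have hηlim : Tendsto η atTop (𝓝 0) := by
    rw [← Finset.sum_const_zero (s := Finset.range ℓ)]
    exact tendsto_finsetSum _ fun k _ =>
      hq.tendsto_powNorm_sub_truncation hM hMpos hτ0 ((hdom.1 _).mp (hbD k))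
  -- the energy error of the cut-off approximations
  set e : ℕ → ℝ := fun n => Kd * (μ n ^ (1 / 2 - τ) * η n) with he_def
  have hμ : ∀ n, 0 < μ n := hq.pos hMpos
  have hμp : ∀ n (s : ℝ), 0 ≤ μ n ^ s := fun n s => Real.rpow_nonneg (hμ n).le s
  have he0 : ∀ n, 0 ≤ e n := fun n => mul_nonneg hKd (mul_nonneg (hμp n _) (hη0 n))
  have helim : Tendsto e atTop (𝓝 0) := by
    have h1 : Tendsto (fun n => Kd * (μ 0 ^ (1 / 2 - τ) * η n)) atTop (𝓝 0) := by
      simpa using (hηlim.const_mul (μ 0 ^ (1 / 2 - τ))).const_mul Kd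
    refine squeeze_zero he0 (fun n => ?_) h1
    have := Real.rpow_le_rpow_of_nonpos (hμ 0) (hq.monotone (Nat.zero_le n))
      (show 1 / 2 - τ ≤ 0 by linarith)
    have := hη0 n
    simp only [he_def]
    gcongr
  set κ := r 0 ^ (-(1 / 2) : ℝ) with hκ
  set C₁ := (1 + r j ^ (1 / 2 : ℝ) * κ) * C with hC₁
  have hsm : Tendsto (fun n => κ * (C * e n)) atTop (𝓝 0) := by
    simpa using (helim.const_mul C).const_mul κ
  refine ⟨Kd + Ki * (C₁ + 1) * Kd, ?_⟩
  filter_upwards [eventually_gt_atTop j, helim.eventually_le_const hε,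
    hsm.eventually_lt_const one_pos] with n hjn hen hκn
  change _ ≤ _ * η n
  set p : ℕ → H := fun k => ι.symm (truncation q n (ι (b k))) with hp
  have hpV : ∀ k, p k ∈ trialSpace (fun k => ι.symm (q k)) n := fun k =>
    symm_truncation_mem_trialSpace n _
  have hpe : ∀ k < ℓ, powNorm A (1 / 2) (b k - p k) ≤ e n := fun k hk => by
    refine (hdir n (b k) (hbD k)).2.trans ?_
    have := hηk n k hk
    have := hμp n (1 / 2 - τ)
    simp only [he_def]
    gcongr
  have hvV := (hv n).mem_trialSpace hjn
  have hvτ := hdom.trialSpace_le hM hMpos hq hτ0 n hvV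
  have hvD := (hv n).mem_domain hjn
  have hv1 : ‖v n j‖ = 1 := (hv n).orthonormal.norm_eq_one ⟨j, hjn⟩
  have henergy := he.energy_normalizedComponent_sub_le hA hpos hvD hv1
    (hritz _ n (L n) (v n) (hv n) hjn p (e n) (fun k _ => hpV k) hpe hen) hκn
  rw [← hκ, ← mul_assoc, ← hC₁] at henergy
  set x := normalizedComponent b r ℓ j (v n j) with hx
  have hxt : truncation b ℓ x = x := truncation_normalizedComponent hjlt _
  have hx1 : ‖x‖ = 1 := norm_normalizedComponent ℓ j _
  have hxD : ∀ s : ℝ, 0 ≤ s → x ∈ (pow A s).domain := fun s hs => by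
    rw [← hxt]; exact he.truncation_mem_pow_domain hA hpos hs ℓ x
  -- the cut-off approximation of the target eigenvector
  set px : H := ∑ k ∈ Finset.range ℓ, inner ℂ (b k) x • p k with hpx
  have hpxV : px ∈ trialSpace (fun k => ι.symm (q k)) n :=
    Submodule.sum_mem _ fun k _ => Submodule.smul_mem _ _ (hpV k)
  have hpxτ := hdom.trialSpace_le hM hMpos hq hτ0 n hpxV
  have hpxD := (hv n).trialSpace_le hpxV
  have hdiff : x - px = ∑ k ∈ Finset.range ℓ, inner ℂ (b k) x • (b k - p k) := by
    nth_rewrite 1 [← hxt]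
    rw [truncation, hpx, ← Finset.sum_sub_distrib]
    exact Finset.sum_congr rfl fun k _ => (smul_sub _ _ _).symm
  have hcoef : ∀ k, ‖inner ℂ (b k) x‖ ≤ 1 := fun k => by
    have h1 := norm_inner_le_norm (𝕜 := ℂ) (b k) x
    rwa [hx1, b.orthonormal.norm_eq_one, one_mul] at h1
  have hsum : ∀ s : ℝ, 0 ≤ s → (∀ k, p k ∈ (pow A s).domain) →
      powNorm A s (x - px) ≤ ∑ k ∈ Finset.range ℓ, powNorm A s (b k - p k) := fun s hs hps => by
    rw [hdiff]
    refine (powNorm_sum_smul_le _ (fun k _ => Submodule.sub_mem _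
      (he.basis_mem_pow_domain hA hpos hs k) (hps k)) _).trans
      (Finset.sum_le_sum fun k _ => mul_le_of_le_one_left (powNorm_nonneg _ _) (hcoef k))
  have h1 : powNorm A τ (x - px) ≤ Kd * η n := by
    refine (hsum τ hτ0 fun k => hdom.trialSpace_le hM hMpos hq hτ0 n (hpV k)).trans ?_
    rw [hη, Finset.mul_sum]
    exact Finset.sum_le_sum fun k _ => (hdir n (b k) (hbD k)).1
  have h2 : powNorm A (1 / 2) (x - px) ≤ e n := by
    refine (hsum (1 / 2) (by norm_num) fun k => (hv n).trialSpace_le (hpV k)).trans ?_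
    simp only [he_def, hη]
    rw [Finset.mul_sum, Finset.mul_sum]
    exact Finset.sum_le_sum fun k _ => (hdir n (b k) (hbD k)).2
  have h3 : powNorm A (1 / 2) (px - v n j) ≤ (C₁ + 1) * e n := by
    have h4 : px - v n j = (x - v n j) - (x - px) := by abel
    rw [h4]
    refine (powNorm_sub_le (Submodule.sub_mem _ (hxD _ (by norm_num)) hvD)
      (Submodule.sub_mem _ (hxD _ (by norm_num)) hpxD)).trans ?_
    linarith
  have h4 : powNorm A τ (px - v n j) ≤ Ki * (C₁ + 1) * Kd * η n := by
    refine (hinv n _ (Submodule.sub_mem _ hpxV hvV)).trans ?_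
    have h5 : μ n ^ (τ - 1 / 2) * μ n ^ (1 / 2 - τ) = 1 := by
      rw [← Real.rpow_add (hμ n)]; simp
    have h6 := hμp n (τ - 1 / 2)
    calc _ ≤ Ki * (μ n ^ (τ - 1 / 2) * ((C₁ + 1) * e n)) := by gcongr
      _ = Ki * (C₁ + 1) * Kd * (μ n ^ (τ - 1 / 2) * μ n ^ (1 / 2 - τ)) * η n := by
        simp only [he_def]; ring
      _ = _ := by rw [h5, mul_one]
  have h5 : x - v n j = (x - px) + (px - v n j) := by abel
  rw [h5]
  refine (powNorm_add_le (Submodule.sub_mem _ (hxD τ hτ0) hpxτ)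
    (Submodule.sub_mem _ hpxτ hvτ)).trans ?_
  linarith

end Convergence

end FracRitz

theorem theorem4p3
    {H G : Type*}
    [NormedAddCommGroup H] [InnerProductSpace ℂ H] [CompleteSpace H]
    [NormedAddCommGroup G] [InnerProductSpace ℂ G] [CompleteSpace G]
    -- the spaces `H` and `G` have the same elements and equivalent norms
    (ι : H ≃L[ℂ] G)
    (A : H →ₗ.[ℂ] H) (hA : IsSelfAdjoint A) (hApos : FracRitz.IsPositiveDefinite A)
    (lam : ℕ → ℝ) (u : ℕ → H) (hu : FracRitz.IsEigenEnumeration A lam u)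
    (M : G →ₗ.[ℂ] G) (hM : IsSelfAdjoint M) (hMpos : FracRitz.IsPositiveDefinite M)
    (hMcpt : IsCompactOperator (FracRitz.inverse M))
    (μ : ℕ → ℝ) (q : ℕ → G) (hq : FracRitz.IsEigenEnumeration M μ q)
    -- the Rayleigh-Ritz eigenpairs for the trial vectors `q 0, …, q (n - 1)`
    (Lam : ℕ → ℕ → ℝ) (v : ℕ → ℕ → H)
    (hv : ∀ n, FracRitz.IsRayleighRitz A (fun k => ι.symm (q k)) n (Lam n) (v n))
    (τ σ : ℝ) (hτ : 1 / 2 < τ) (hσ : 2 * τ - 1 / 2 ≤ σ)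
    (hdom : FracRitz.SameDomain ι A M τ)
    (hemb : FracRitz.ContEmbedded ι A M (2 * τ - 1 / 2))
    -- the first `ℓ` eigenvectors span a sum of full eigenspaces of `A`
    (ℓ : ℕ) (hℓ : ∀ j < ℓ, lam j < lam ℓ)
    (hratio : ∀ j < ℓ,
      (fun n : ℕ =>
        (∑' k : ℕ, μ (n + k) ^ (4 * τ - 1) * ‖inner ℂ (q (n + k)) (ι (u j))‖ ^ 2) /
          (∑' k : ℕ, μ (n + k) ^ (2 * τ) * ‖inner ℂ (q (n + k)) (ι (u j))‖ ^ 2))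
        =O[atTop] fun n : ℕ => μ n ^ (2 * τ - 1))
    (hsmooth : ∀ j < ℓ, ι (u j) ∈ (FracRitz.pow M σ).domain) :
    (∃ w : ℕ → ℕ → H, ∀ j < ℓ,
      (∀ n, ‖w n j‖ = 1 ∧ FracRitz.InEigenspace A (lam j) (w n j)) ∧
      (∀ n, j < n → w n j - v n j ∈ (FracRitz.pow A τ).domain) ∧
      (fun n : ℕ => FracRitz.powNorm A τ (w n j - v n j)) =o[atTop]
        fun n : ℕ => μ n ^ (τ - σ)) ∧
    -- for a simple eigenvalue and correctly oriented `v n j`, the fixed eigenvector `u j` serves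
    (∀ j < ℓ, (∀ k, lam k = lam j → k = j) →
      (∀ n, j < n → 0 ≤ (inner ℂ (u j) (v n j)).re ∧ (inner ℂ (u j) (v n j)).im = 0) →
      (∀ n, j < n → u j - v n j ∈ (FracRitz.pow A τ).domain) ∧
      (fun n : ℕ => FracRitz.powNorm A τ (u j - v n j)) =o[atTop]
        fun n : ℕ => μ n ^ (τ - σ)) := by
  have hτ0 : 0 < τ := by linarith
  obtain ⟨qb, hqb⟩ := hq.exists_hilbertBasis_of_isCompactOperator hM hMpos hMcpt
  obtain rfl : (qb : ℕ → G) = q := funext hqb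
  -- Completeness of the `u k` is not assumed, but follows from compactness of `A ^ (-τ)`.
  have hAcpt := hdom.isCompactOperator_rpow hA hApos hM hMpos hτ0.le
    (hq.isCompactOperator_rpow hM hMpos hMcpt hτ0)
  obtain ⟨ub, hub⟩ := hu.exists_hilbertBasis (hu.orthogonal_eq_bot hA hApos hτ0 hAcpt)
  obtain rfl : (ub : ℕ → H) = u := funext hub
  have hlittle : (fun n => ∑ k ∈ Finset.range ℓ,
      FracRitz.powNorm M τ (ι (ub k) - FracRitz.truncation qb n (ι (ub k))))
      =o[atTop] fun n => μ n ^ (τ - σ) :=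
    IsLittleO.fun_sum fun k hk => hq.powNorm_sub_truncation_isLittleO hM hMpos hτ0.le
      (by linarith) (hsmooth k (Finset.mem_range.mp hk))
  have hmem : ∀ j < ℓ, ∀ n, j < n →
      FracRitz.normalizedComponent ub lam ℓ j (v n j) - v n j ∈ (FracRitz.pow A τ).domain := by
    intro j hj n hjn
    refine Submodule.sub_mem _ ?_
      (hdom.trialSpace_le hM hMpos hq hτ0.le n ((hv n).mem_trialSpace hjn))
    rw [← FracRitz.truncation_normalizedComponent hj]
    exact hu.truncation_mem_pow_domain hA hApos hτ0.le ℓ _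
  have hconv : ∀ j < ℓ, (fun n => FracRitz.powNorm A τ
      (FracRitz.normalizedComponent ub lam ℓ j (v n j) - v n j))
      =o[atTop] fun n => μ n ^ (τ - σ) := by
    intro j hj
    obtain ⟨K, hK⟩ := hdom.exists_ritz_error_bound hA hApos hu hM hMpos hq hτ.le hv (hℓ j hj)
    refine IsBigO.trans_isLittleO (IsBigO.of_bound |K| ?_) hlittle
    filter_upwards [hK] with n hn
    rw [Real.norm_of_nonneg (FracRitz.powNorm_nonneg _ _), Real.norm_eq_abs, ← abs_mul]
    exact hn.trans (le_abs_self _)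
  refine ⟨⟨fun n j => FracRitz.normalizedComponent ub lam ℓ j (v n j), fun j hj =>
    ⟨fun n => ⟨FracRitz.norm_normalizedComponent ℓ j _,
      hu.inEigenspace_normalizedComponent hA hApos ℓ j _⟩, hmem j hj, hconv j hj⟩⟩, ?_⟩
  intro j hj hsimple horient
  have heq : ∀ n, j < n → FracRitz.normalizedComponent ub lam ℓ j (v n j) = ub j := fun n hn =>
    FracRitz.normalizedComponent_eq_of_simple hj hsimple (horient n hn).1 (horient n hn).2
  refine ⟨fun n hn => heq n hn ▸ hmem j hj n hn, (hconv j hj).congr' ?_ EventuallyEq.rfl⟩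
  filter_upwards [eventually_gt_atTop j] with n hn
  rw [heq n hn]
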